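/- Let $D\ge 2$. For finite $X\subset\mathbb Z$ let $\mathcal A_X=\bigotimes_{x\in X}M_D(\mathbb C)$, with $\mathcal A_X\subset\mathcal A_Y$ for $X\subset Y$ via $A\mapsto A\otimes\mathbb 1$, let $\mathcal A_L=\mathcal A_{[-L,L]}$, and let $\mathcal A$ (the quasi-local algebra) be the operator-norm completion of $\bigcup_X\mathcal A_X$. For a local observable $A$ let its support $S_A$ be the minimal-length interval $[x,y]\subset\mathbb Z$ with $A\in\mathcal A_{[x,y]}$ (any one-point interval if $A$ is a multiple of the identity), and let $d(X,Y)=\inf_{x\in X,y\in Y}|x-y|$. Let $\Phi$ be a nearest-neighbor interaction, i.e. $\Phi(X)=\Phi(X)^*\in\mathcal A_X$ for all finite $X\subset\mathbb Z$ and $\Phi(X)\neq0$ only if $X=\{x,x+1\}$ for some $x$; write $\Phi_{x,x+1}=\Phi(\{x,x+1\})$ and assume $\|\Phi\|=\sup_x\|\Phi_{x,x+1}\|<\infty$. Let $\mathcal F\subset\mathbb Z$ have minimal spacing $\sigma_{\mathcal F}=\min\{|x-y|:x,y\in\mathcal F,\ x\ne y\}$ (with $\sigma_{\mathcal F}=\infty$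 if $\mathcal F$ has at most one point). For each $x\in\mathcal F$ let $V_x=V_x^*\in\mathcal A_{\{x\}}$ be a Hermitian $D\times D$ matrix with $D$ distinct eigenvalues $\gamma^{(x)}_1,\dots,\gamma^{(x)}_D$, put $\Gamma_x=\min_{i\neq j}|\gamma^{(x)}_i-\gamma^{(x)}_j|$, and let $\lambda_x\in\mathbb R\setminus\{0\}$. For $L\in\mathbb N$ set $$H_L(\vec\lambda)=\sum_{x=-L}^{L-1}\Phi_{x,x+1}+\sum_{x\in\mathcal F\cap[-L,L]}\lambda_xV_x,\qquad \tau_t^{H_L(\vec\lambda)}(A)=e^{itH_L(\vec\lambda)}Ae^{-itH_L(\vec\lambda)} .$$ For $\mu>0$ put $$c_\mu=\sum_{x\in\mathbb Z}\frac{e^{-\mu|x|}}{(1+|x|)^2},\qquad K_\mu=\sup_{x,y\in\mathbb Z}\sum_{z\in\mathbb Z}\frac{e^{-\mu(|x-z|+|y-z|-|x-y|)}(1+|x-y|)^2}{(1+|x-z|)^2(1+|z-y|)^2},$$ $$C_0=\frac{10c_\mu}{K_\mu},\qquad v=8e^{\mu}K_\mu\|\Phi\|,\qquad C=\frac{444\,C_0^2e^{5\mu}}{\mu(1-e^{-\mu})}\|\Phi\|\binom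 D2^2 ,$$ $$G_N(t)=v|t|(1+v|t|)^{N-1}e^{v|t|},\qquad F_N(d)=(\mu d)^Ne^{-\mu d}.$$ **Theorem 3.1.** Let $\mu>0$ and suppose $\sigma_{\mathcal F}>\max\{1/\mu,2\}$. Then $C>0$ whenever $\|\Phi\|>0$, and for all couplings $(\lambda_x)_{x\in\mathcal F}$ in $\mathbb R\setminus\{0\}$ the following holds. (i) For all $L\in\mathbb N$, all $A,B\in\mathcal A_L$ with $\max S_A+3<\min S_B-3$, and all $t\in\mathbb R$, $$\big\|[\tau_t^{H_L(\vec\lambda)}(A),B]\big\|\le\frac{C^N}{\prod_{x\in Z}|\lambda_x|\Gamma_x}\,\|A\|\,\|B\|\,G_N(t)\,F_N\big(d(S_A,S_B)\big),$$ where $Z=[\max S_A+3,\ \min S_B-3]\cap\mathcal F$ and $N=|Z|$. The constant $C$ does not depend on $L$, $A$, $B$, $t$, $\mathcal F$, $(V_x)$ or $\vec\lambda$. (ii) For every $t\in\mathbb R$ the limit $\tau_t(A)=\lim_{L\to\infty}\tau_t^{H_L(\vec\lambda)}(A)$ exists in norm for all $A\in\mathcal A$ and defines a *-automorphism $\tau_t$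 of $\mathcal A$; and for all local $A,B$ with $\max S_A+3<\min S_B-3$ and all $t\in\mathbb R$, $\|[\tau_t(A),B]\|$ satisfies the bound in (i) with the same $Z$, $N$ and constants. -/

import Mathlib

open Filter Topology

noncomputable section

namespace SpinChain

/-! ### Configurations and the Hilbert space of the chain -/

/-- A (classical) configuration of the chain `ℤ` with `D` basis states per site. -/
abbrev Config (D : ℕ) : Type := ℤ → Fin D

/-- The Hilbert space `ℓ²(Config D)`.  Its standard basis vectors are labelled by configurations,
and for every finite `X ⊂ ℤ` it is `(⨂_{x ∈ X} ℂ^D) ⊗ ℓ²(configurations off X)`. -/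
abbrev HSpace (D : ℕ) : Type := lp (fun _ : Config D => ℂ) 2

/-- Bounded operators on `HSpace D`; all observables live in this C*-algebra. -/
abbrev Op (D : ℕ) : Type := HSpace D →L[ℂ] HSpace D

/-- `⨂_{x ∈ X} M_D(ℂ)`, written as matrices indexed by the configurations on `X`. -/
abbrev LocalMatrix (D : ℕ) (X : Finset ℤ) : Type := Matrix (X → Fin D) (X → Fin D) ℂ

/-- The configuration that agrees with `η` on `X` and with `σ` off `X`. -/
def replace {D : ℕ} (X : Finset ℤ) (η : X → Fin D) (σ : Config D) : Config D :=
  fun x => if h : x ∈ X then η ⟨x, h⟩ else σ x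

@[simp] lemma restrict_replace {D : ℕ} (X : Finset ℤ) (η : X → Fin D) (σ : Config D) :
    X.restrict (replace X η σ) = η := by
  funext x
  simp [replace]

@[simp] lemma replace_replace {D : ℕ} (X : Finset ℤ) (η ξ : X → Fin D) (σ : Config D) :
    replace X η (replace X ξ σ) = replace X η σ := by
  funext x
  by_cases h : x ∈ X <;> simp [replace, h]

@[simp] lemma replace_restrict {D : ℕ} (X : Finset ℤ) (σ : Config D) :
    replace X (X.restrict σ) σ = σ := by
  funext x
  by_cases h : x ∈ X <;> simp [replace, h]

lemma replace_eq_iff {D : ℕ} (X : Finset ℤ) (η : X → Fin D) (σ ρ : Config D) :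
    replace X η ρ = σ ↔ η = X.restrict σ ∧ ρ = replace X (X.restrict ρ) σ := by
  constructor
  · rintro rfl
    simp
  · rintro ⟨rfl, h⟩
    rw [h]
    simp

/-- The function on configurations that results from `M ⊗ 𝟙` acting on `ψ`. -/
def localFun {D : ℕ} (X : Finset ℤ) (M : LocalMatrix D X) (ψ : Config D → ℂ) (σ : Config D) : ℂ :=
  ∑ η : X → Fin D, M (X.restrict σ) η * ψ (replace X η σ)

lemma sum_replace_le {D : ℕ} (X : Finset ℤ) (η : X → Fin D) (ψ : HSpace D)
    (s : Finset (Config D)) :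
    ∑ σ ∈ s, ‖ψ (replace X η σ)‖ ^ 2 ≤ (Fintype.card (X → Fin D) : ℝ) * ‖ψ‖ ^ 2 := by
  classical
  have h2 : (0 : ℝ) < (2 : ENNReal).toReal := by norm_num
  have hfib : ∀ ξ : X → Fin D,
      ∑ σ ∈ s with X.restrict σ = ξ, ‖ψ (replace X η σ)‖ ^ 2 ≤ ‖ψ‖ ^ 2 := by
    intro ξ
    have hinj : Set.InjOn (replace X η) (s.filter fun σ => X.restrict σ = ξ : Finset (Config D)) := by
      intro σ hσ ρ hρ h
      simp only [Finset.coe_filter, Set.mem_ofPred_eq] at hσ hρ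
      have := congrArg (replace X ξ) h
      simp only [replace_replace] at this
      rwa [← hσ.2, replace_restrict, hσ.2, ← hρ.2, replace_restrict] at this
    rw [← Finset.sum_image (f := fun ρ => ‖ψ ρ‖ ^ 2) hinj]
    simpa using lp.sum_rpow_le_norm_rpow h2 ψ _
  calc ∑ σ ∈ s, ‖ψ (replace X η σ)‖ ^ 2
      = ∑ ξ : X → Fin D, ∑ σ ∈ s with X.restrict σ = ξ, ‖ψ (replace X η σ)‖ ^ 2 :=
        (Finset.sum_fiberwise s _ _).symm
    _ ≤ ∑ _ξ : X → Fin D, ‖ψ‖ ^ 2 := Finset.sum_le_sum fun ξ _ => hfib ξ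
    _ = _ := by simp

/-- A crude bound for the operator norm of `M ⊗ 𝟙`. -/
def crudeBound {D : ℕ} (X : Finset ℤ) (M : LocalMatrix D X) : ℝ :=
  (Fintype.card (X → Fin D) : ℝ) ^ 2 * ∑ ξ : X → Fin D, ∑ η : X → Fin D, ‖M ξ η‖

lemma crudeBound_nonneg {D : ℕ} (X : Finset ℤ) (M : LocalMatrix D X) : 0 ≤ crudeBound X M := by
  unfold crudeBound
  positivity

lemma sum_localFun_le {D : ℕ} (X : Finset ℤ) (M : LocalMatrix D X) (ψ : HSpace D)
    (s : Finset (Config D)) :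
    ∑ σ ∈ s, ‖localFun X M ψ σ‖ ^ 2 ≤ (crudeBound X M * ‖ψ‖) ^ 2 := by
  set n : ℝ := (Fintype.card (X → Fin D) : ℝ) with hn
  set B : ℝ := ∑ ξ : X → Fin D, ∑ η : X → Fin D, ‖M ξ η‖ with hB
  have hB0 : 0 ≤ B := by positivity
  have hM : ∀ ξ η, ‖M ξ η‖ ≤ B := fun ξ η =>
    (Finset.single_le_sum (f := fun η => ‖M ξ η‖) (fun _ _ => norm_nonneg _)
      (Finset.mem_univ η)).trans
    (Finset.single_le_sum (f := fun ξ => ∑ η, ‖M ξ η‖)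
      (fun _ _ => Finset.sum_nonneg fun _ _ => norm_nonneg _) (Finset.mem_univ ξ))
  have hpt : ∀ σ, ‖localFun X M ψ σ‖ ^ 2
      ≤ n * ∑ η : X → Fin D, B ^ 2 * ‖ψ (replace X η σ)‖ ^ 2 := by
    intro σ
    have h1 : ‖localFun X M ψ σ‖ ≤ ∑ η : X → Fin D, B * ‖ψ (replace X η σ)‖ := by
      refine (norm_sum_le _ _).trans (Finset.sum_le_sum fun η _ => ?_)
      rw [norm_mul]
      gcongr
      exact hM _ _
    calc ‖localFun X M ψ σ‖ ^ 2 ≤ (∑ η : X → Fin D, B * ‖ψ (replace X η σ)‖) ^ 2 := by gcongr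
      _ ≤ n * ∑ η : X → Fin D, (B * ‖ψ (replace X η σ)‖) ^ 2 := by
        simpa [hn] using sq_sum_le_card_mul_sum_sq (s := (Finset.univ : Finset (X → Fin D)))
          (f := fun η => B * ‖ψ (replace X η σ)‖)
      _ = _ := by simp only [mul_pow]
  calc ∑ σ ∈ s, ‖localFun X M ψ σ‖ ^ 2
      ≤ ∑ σ ∈ s, n * ∑ η : X → Fin D, B ^ 2 * ‖ψ (replace X η σ)‖ ^ 2 :=
        Finset.sum_le_sum fun σ _ => hpt σ
    _ = n * B ^ 2 * ∑ η : X → Fin D, ∑ σ ∈ s, ‖ψ (replace X η σ)‖ ^ 2 := by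
        rw [← Finset.mul_sum, Finset.sum_comm, mul_assoc, Finset.mul_sum (a := B ^ 2)]
        simp only [Finset.mul_sum]
    _ ≤ n * B ^ 2 * ∑ _η : X → Fin D, n * ‖ψ‖ ^ 2 := by
        gcongr with η
        exact sum_replace_le X η ψ s
    _ = n ^ 3 * (B * ‖ψ‖) ^ 2 := by
        simp only [Finset.sum_const, Finset.card_univ, nsmul_eq_mul, ← hn]
        ring
    _ ≤ n ^ 4 * (B * ‖ψ‖) ^ 2 := by
        have hn4 : n ^ 3 ≤ n ^ 4 := by
          rcases Nat.eq_zero_or_pos (Fintype.card (X → Fin D)) with h | h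
          · simp [hn, h]
          · exact pow_le_pow_right₀ (by rw [hn]; exact_mod_cast h) (by norm_num)
        gcongr
    _ = (crudeBound X M * ‖ψ‖) ^ 2 := by
        simp only [crudeBound, ← hn, ← hB]
        ring

/-- `M ⊗ 𝟙` as a linear map on `HSpace D`. -/
def localLinear {D : ℕ} (X : Finset ℤ) (M : LocalMatrix D X) : HSpace D →ₗ[ℂ] HSpace D where
  toFun ψ := ⟨localFun X M ψ, memℓp_gen' (C := (crudeBound X M * ‖ψ‖) ^ 2) fun s => by
    simpa using sum_localFun_le X M ψ s⟩
  map_add' ψ φ := by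
    ext σ
    change localFun X M (ψ + φ : HSpace D) σ = localFun X M ψ σ + localFun X M φ σ
    simp [localFun, mul_add, Finset.sum_add_distrib]
  map_smul' c ψ := by
    ext σ
    simp only [localFun, lp.coeFn_smul, Pi.smul_apply, smul_eq_mul, RingHom.id_apply,
      Finset.mul_sum]
    exact Finset.sum_congr rfl fun η _ => by ring

/-- `M ⊗ 𝟙` as a bounded operator on the Hilbert space of the chain:
`((M ⊗ 𝟙) ψ)(σ) = ∑_η M(σ|_X, η) ψ(η on X, σ off X)`. -/
def localOp {D : ℕ} (X : Finset ℤ) (M : LocalMatrix D X) : Op D :=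
  (localLinear X M).mkContinuous (crudeBound X M) fun ψ =>
    lp.norm_le_of_forall_sum_le (by norm_num)
      (mul_nonneg (crudeBound_nonneg X M) (norm_nonneg ψ)) fun s => by
        simp only [ENNReal.toReal_ofNat, Real.rpow_ofNat]
        exact sum_localFun_le X M ψ s

lemma localOp_apply {D : ℕ} (X : Finset ℤ) (M : LocalMatrix D X) (ψ : HSpace D) (σ : Config D) :
    localOp X M ψ σ = ∑ η : X → Fin D, M (X.restrict σ) η * ψ (replace X η σ) := rfl

lemma localOp_mul {D : ℕ} (X : Finset ℤ) (M N : LocalMatrix D X) :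
    localOp X (M * N) = localOp X M * localOp X N := by
  ext ψ σ
  simp only [mul_apply_eq_comp, localOp_apply, restrict_replace, replace_replace,
    Matrix.mul_apply, Finset.sum_mul, Finset.mul_sum]
  rw [Finset.sum_comm]
  exact Finset.sum_congr rfl fun _ _ => Finset.sum_congr rfl fun _ _ => by ring

lemma localOp_one {D : ℕ} (X : Finset ℤ) : localOp X (1 : LocalMatrix D X) = 1 := by
  ext ψ σ
  simp [localOp_apply, Matrix.one_apply]

lemma localOp_single {D : ℕ} [DecidableEq (Config D)] (X : Finset ℤ) (M : LocalMatrix D X)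
    (σ : Config D) :
    localOp X M (lp.single 2 σ 1)
      = ∑ ξ : X → Fin D, M ξ (X.restrict σ) • lp.single 2 (replace X ξ σ) (1 : ℂ) := by
  ext ρ
  rw [localOp_apply, lp.coeFn_sum, Finset.sum_apply]
  simp only [lp.coeFn_smul, Pi.smul_apply, lp.single_apply, smul_eq_mul, Pi.single_apply,
    mul_ite, mul_one, mul_zero]
  by_cases h : ρ = replace X (X.restrict ρ) σ
  · rw [Finset.sum_eq_single (X.restrict σ), Finset.sum_eq_single (X.restrict ρ),
      if_pos h, if_pos ((replace_eq_iff X _ σ ρ).2 ⟨rfl, h⟩)]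
    · intro ξ _ hξ
      rw [if_neg]
      rintro rfl
      simp at hξ
    · simp
    · intro η _ hη
      rw [if_neg]
      exact fun h' => hη ((replace_eq_iff X η σ ρ).1 h').1
    · simp
  · rw [Finset.sum_eq_zero, Finset.sum_eq_zero]
    · intro ξ _
      rw [if_neg]
      rintro rfl
      simp at h
    · intro η _
      rw [if_neg]
      exact fun h' => h ((replace_eq_iff X η σ ρ).1 h').2

lemma localOp_star {D : ℕ} (X : Finset ℤ) (M : LocalMatrix D X) :
    localOp X (star M) = star (localOp X M) := by
  classical
  ext ψ σ
  have h1 : (star (localOp X M) ψ : HSpace D) σ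
      = inner ℂ (localOp X M (lp.single 2 σ (1 : ℂ))) ψ := by
    rw [ContinuousLinearMap.star_eq_adjoint, ← ContinuousLinearMap.adjoint_inner_right,
      lp.inner_single_left]
    simp
  rw [h1, localOp_single, sum_inner, localOp_apply]
  refine Finset.sum_congr rfl fun ξ _ => ?_
  rw [inner_smul_left, lp.inner_single_left]
  simp [Matrix.star_apply]

/-- The unital *-homomorphism `⨂_{x ∈ X} M_D(ℂ) → B(HSpace D)`, `M ↦ M ⊗ 𝟙`. -/
def localHom (D : ℕ) (X : Finset ℤ) : LocalMatrix D X →⋆ₐ[ℂ] Op D where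
  toFun := localOp X
  map_one' := localOp_one X
  map_mul' := localOp_mul X
  map_zero' := by
    ext ψ σ
    simp [localOp_apply]
  map_add' M N := by
    ext ψ σ
    simp [localOp_apply, add_mul, Finset.sum_add_distrib]
  commutes' c := by
    ext ψ σ
    simp [localOp_apply, Algebra.algebraMap_eq_smul_one, Matrix.one_apply]
  map_star' := localOp_star X

lemma localHom_injective (D : ℕ) [NeZero D] (X : Finset ℤ) :
    Function.Injective (localHom D X) := by
  classical
  intro M N h
  ext ξ η
  have := congrArg (fun T : Op D => T (lp.single 2 (replace X η (fun _ => 0)) 1)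
    (replace X ξ (fun _ => 0))) h
  have key : ∀ P : LocalMatrix D X, localHom D X P (lp.single 2 (replace X η (fun _ => 0)) 1)
      (replace X ξ (fun _ => 0)) = P ξ η := by
    intro P
    change localOp X P _ _ = _
    rw [localOp_apply, Finset.sum_eq_single η]
    · simp
    · intro ζ _ hζ
      rw [lp.single_apply, Pi.single_apply, if_neg, mul_zero]
      intro h'
      exact hζ (by simpa using congrArg X.restrict h')
    · simp
  rwa [key, key] at this

open scoped Matrix.Norms.L2Operator in
/-- The embedding preserves the operator norm, so that norms computed in `Op D` are those of
`⨂_{x ∈ X} M_D(ℂ)`. -/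
lemma norm_localHom (D : ℕ) [NeZero D] (X : Finset ℤ) (M : LocalMatrix D X) :
    ‖localHom D X M‖ = ‖M‖ :=
  NonUnitalStarAlgHom.norm_map (localHom D X) (localHom_injective D X) M

/-- The algebra `𝒜_X = ⨂_{x ∈ X} M_D(ℂ)` of observables on the finite set `X`, where
`A ∈ 𝒜_X` is identified with `A ⊗ 𝟙`. -/
def siteAlgebra (D : ℕ) (X : Finset ℤ) : StarSubalgebra ℂ (Op D) := (localHom D X).range

/-- `M ↦ M ⊗ 𝟙_{Y ∖ X}`, for `X ⊆ Y`. -/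
def extend {D : ℕ} {X Y : Finset ℤ} (h : X ⊆ Y) (M : LocalMatrix D X) : LocalMatrix D Y :=
  fun ξ η => if ∀ y : Y, (y : ℤ) ∉ X → ξ y = η y then
    M (fun x => ξ ⟨x, h x.2⟩) (fun x => η ⟨x, h x.2⟩) else 0

lemma localOp_extend {D : ℕ} {X Y : Finset ℤ} (h : X ⊆ Y) (M : LocalMatrix D X) :
    localOp Y (extend h M) = localOp X M := by
  ext ψ σ
  rw [localOp_apply, localOp_apply]
  symm
  refine Finset.sum_of_injOn (fun η => Y.restrict (replace X η σ)) ?_ (by simp) ?_ ?_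
  · intro η _ ζ _ hηζ
    funext x
    have := congrFun hηζ ⟨x, h x.2⟩
    simpa [replace] using this
  · intro η _ hη
    rw [extend, if_neg, zero_mul]
    intro hag
    refine hη ⟨fun x => η ⟨x, h x.2⟩, by simp, ?_⟩
    funext y
    by_cases hy : (y : ℤ) ∈ X
    · simp [replace, hy]
    · simpa [replace, hy] using hag y hy
  · intro η _
    rw [extend, if_pos]
    · congr 1
      · congr 1
        funext x
        simp [replace]
      · refine congrArg (fun ρ => ψ ρ) ?_
        funext x
        by_cases hx : x ∈ Y
        · simp [replace, hx]
        · have hx' : x ∉ X := fun hh => hx (h hh)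
          simp [replace, hx, hx']
    · intro y hy
      simp [replace, hy]

lemma siteAlgebra_mono (D : ℕ) : Monotone (siteAlgebra D) := by
  rintro X Y h _ ⟨M, rfl⟩
  exact ⟨extend h M, localOp_extend h M⟩

/-- The algebra of local observables `𝒜_loc`. -/
def localAlgebra (D : ℕ) : StarSubalgebra ℂ (Op D) := ⨆ X : Finset ℤ, siteAlgebra D X

/-- `𝒜_loc` is the union of the algebras `𝒜_X`. -/
lemma coe_localAlgebra (D : ℕ) :
    (localAlgebra D : Set (Op D)) = ⋃ X : Finset ℤ, (siteAlgebra D X : Set (Op D)) :=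
  StarSubalgebra.coe_iSup_of_directed (siteAlgebra_mono D).directed_le

/-- The quasi-local algebra `𝒜`, the operator norm completion of `𝒜_loc`. -/
def quasiLocalAlgebra (D : ℕ) : StarSubalgebra ℂ (Op D) := (localAlgebra D).topologicalClosure

/-! ### Supports and distances -/

/-- `[x, y]` is an interval of minimal length with `A ∈ 𝒜_{[x,y]}`: `S_A = [x, y]`.  (It is unique
unless `A` is a multiple of the identity.) -/
def IsSupport {D : ℕ} (A : Op D) (x y : ℤ) : Prop :=
  x ≤ y ∧ A ∈ siteAlgebra D (Finset.Icc x y) ∧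
    ∀ x' y' : ℤ, x' ≤ y' → A ∈ siteAlgebra D (Finset.Icc x' y') → y - x ≤ y' - x'

/-- `d(X, Y) = inf |x - y|` over `x ∈ X`, `y ∈ Y`. -/
def setDist (X Y : Set ℤ) : ℝ := sInf (Set.image2 (fun x y : ℤ => |(x : ℝ) - y|) X Y)

/-- The minimal spacing `σ_F = min {|x - y| : x, y ∈ F, x ≠ y}`, with value `⊤` if `F` has at most
one point. -/
def minSpacing (F : Set ℤ) : EReal :=
  ⨅ (x ∈ F) (y ∈ F) (_ : x ≠ y), ((|(x : ℝ) - y| : ℝ) : EReal)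

/-! ### Interactions, Hamiltonians and dynamics -/

/-- `η(X) = η(X)* ∈ 𝒜_X` for all finite `X ⊂ ℤ`. -/
def IsInteraction {D : ℕ} (η : Finset ℤ → Op D) : Prop :=
  ∀ X, IsSelfAdjoint (η X) ∧ η X ∈ siteAlgebra D X

/-- `η(X) ≠ 0` only if `X = {x, x+1}`. -/
def IsNearestNeighbor {D : ℕ} (η : Finset ℤ → Op D) : Prop :=
  ∀ X, η X ≠ 0 → ∃ x : ℤ, X = {x, x + 1}

/-- `‖η‖ < ∞`. -/
def HasFiniteNorm {D : ℕ} (η : Finset ℤ → Op D) : Prop :=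
  BddAbove (Set.range fun x : ℤ => ‖η {x, x + 1}‖)

/-- `‖η‖ = sup_x ‖η({x, x+1})‖`. -/
def interactionNorm {D : ℕ} (η : Finset ℤ → Op D) : ℝ := ⨆ x : ℤ, ‖η {x, x + 1}‖

/-- A `D × D` matrix acting on the site `x`, as an element of `𝒜_{{x}}`. -/
def onSite {D : ℕ} (x : ℤ) (M : Matrix (Fin D) (Fin D) ℂ) : Op D :=
  localHom D {x} (fun ξ η => M (ξ ⟨x, by simp⟩) (η ⟨x, by simp⟩))

/-- `Γ = min_{i ≠ j} |γ_i - γ_j|` for the eigenvalues `γ_1, …, γ_D` of a Hermitian matrix. -/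
def spectralGap {D : ℕ} {M : Matrix (Fin D) (Fin D) ℂ} (hM : M.IsHermitian) : ℝ :=
  ⨅ p : {p : Fin D × Fin D // p.1 ≠ p.2}, |hM.eigenvalues p.1.1 - hM.eigenvalues p.1.2|

open Classical in
/-- The sites of `F` in the interval `[x, y]`. -/
def sitesIn (F : Set ℤ) (x y : ℤ) : Finset ℤ := (Finset.Icc x y).filter (· ∈ F)

/-- `H_L(λ) = ∑_{x=-L}^{L-1} Φ_{x,x+1} + ∑_{x ∈ F ∩ [-L,L]} λ_x V_x`. -/
def hamiltonian {D : ℕ} (Φ : Finset ℤ → Op D) (F : Set ℤ)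
    (V : ℤ → Matrix (Fin D) (Fin D) ℂ) (lam : ℤ → ℝ) (L : ℕ) : Op D :=
  ∑ x ∈ Finset.Ico (-(L : ℤ)) L, Φ {x, x + 1} +
    ∑ x ∈ sitesIn F (-(L : ℤ)) L, (lam x : ℂ) • onSite x (V x)

/-- The Heisenberg evolution `τ_t^H(A) = e^{itH} A e^{-itH}`. -/
def heisenberg {D : ℕ} (H : Op D) (t : ℝ) (A : Op D) : Op D :=
  NormedSpace.exp ((Complex.I * t) • H) * A * NormedSpace.exp (-(Complex.I * t) • H)

/-- The commutator `[A, B]`. -/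
def opComm {D : ℕ} (A B : Op D) : Op D := A * B - B * A

/-! ### Constants and the functions in the bound -/

/-- `c_μ = ∑_{x ∈ ℤ} e^{-μ|x|} / (1+|x|)²`. -/
def cConst (μ : ℝ) : ℝ := ∑' x : ℤ, Real.exp (-μ * |(x : ℝ)|) / (1 + |(x : ℝ)|) ^ 2

/-- `K_μ = sup_{x,y} ∑_z e^{-μ(|x-z|+|y-z|-|x-y|)} (1+|x-y|)² / ((1+|x-z|)² (1+|z-y|)²)`. -/
def kConst (μ : ℝ) : ℝ :=
  ⨆ p : ℤ × ℤ, ∑' z : ℤ,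
    Real.exp (-μ * (|(p.1 : ℝ) - z| + |(p.2 : ℝ) - z| - |(p.1 : ℝ) - p.2|)) *
      (1 + |(p.1 : ℝ) - p.2|) ^ 2 /
        ((1 + |(p.1 : ℝ) - z|) ^ 2 * (1 + |(z : ℝ) - p.2|) ^ 2)

/-- `C₀ = 10 c_μ / K_μ`. -/
def C₀ (μ : ℝ) : ℝ := 10 * cConst μ / kConst μ

/-- `v = 8 e^μ K_μ ‖Φ‖`. -/
def velocity (μ normΦ : ℝ) : ℝ := 8 * Real.exp μ * kConst μ * normΦ

/-- `C = 444 C₀² e^{5μ} / (μ (1 - e^{-μ})) · ‖Φ‖ · binom(D,2)²`. -/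
def mainConst (μ normΦ : ℝ) (D : ℕ) : ℝ :=
  444 * C₀ μ ^ 2 * Real.exp (5 * μ) / (μ * (1 - Real.exp (-μ))) * normΦ * (D.choose 2 : ℝ) ^ 2

/-- `G_N(t) = v|t| (1+v|t|)^{N-1} e^{v|t|}`, with an integer exponent `N - 1`. -/
def G (v : ℝ) (N : ℕ) (t : ℝ) : ℝ :=
  v * |t| * (1 + v * |t|) ^ ((N : ℤ) - 1) * Real.exp (v * |t|)

/-- `F_N(d) = (μd)^N e^{-μd}`. -/
def decay (μ : ℝ) (N : ℕ) (d : ℝ) : ℝ := (μ * d) ^ N * Real.exp (-μ * d)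

/-- The factor `C^N / ∏_{x ∈ Z} (|λ_x| Γ_x) · G_N(t) F_N(d)` with `N = |Z|`. -/
def boundFactor (D : ℕ) (μ normΦ : ℝ) (lam Γ : ℤ → ℝ) (Z : Finset ℤ) (t d : ℝ) : ℝ :=
  mainConst μ normΦ D ^ Z.card / (∏ x ∈ Z, |lam x| * Γ x) *
    G (velocity μ normΦ) Z.card t * decay μ Z.card d

end SpinChain

end

open SpinChain

/-!
An impurity blocks propagation through its site `x` up to corrections inversely proportional to its
strength.  Let `X` be the sum of the two bonds at `x`.  If `X` is replaced by its block-diagonal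
part `pinch` with respect to the eigenspaces of `V x`, which are one-dimensional, then each of the two
bonds becomes a sum of products `Pₖ aₖ` with the `aₖ` living on one side of `x` only.  The chain
then splits into two commuting halves and nothing is transported across `x`
(`commute_pinch_pinch`, `commute_heisenberg_of_decoupled`).  The off-diagonal part of `X` is
removed by a unitary rotation close to `x`, whose generator `rotor` solves a commutator equation
with `lam x • V x` and hence has norm of order `‖Φ‖ / (|lam x| Γ x)`.  In the rotated frame the
Hamiltonian is decoupled at `x` up to a remainder, supported in `[x - 2, x + 2]`, whose norm is
`‖Φ‖` times the norm of the generator.  No smallness of the generator is needed.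

Transport is followed from left to right.  `TransportBound H B y p` says that observables on
`(-∞, y]` reach `B` with strength at most `p |t|`.  By a Duhamel argument
(`norm_opComm_heisenberg_le`), if `H₀` does not connect `A` to `B`, then transport from `A` to `B`
is bounded by the time integral of the transport from `H - H₀` to `B`.  Removing one bond, one passes
from `y + 1` to `y` at the cost of a time integral (`TransportBound.bond_step`).  Removing, in the
rotated frame, the remainder at an impurity, one passes from `x + 2` to `x - 1` at the cost of a
factor of order `‖Φ‖ / (|lam x| Γ x) * (1 + 8 ‖Φ‖ |t|)` (`TransportBound.impurity_step`).  Since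
impurities are at least three sites apart, these steps can be combined
(`Chain.exists_transportBound`): `n` impurities and `m` ordinary bonds give the product of the
impurity factors times `(2 ‖Φ‖ |t|) ^ m / m!`, where the distance is `m + 3 n`.  The factor
`e ^ (5 μ)` in the constant pays for the three bonds that are lost at each impurity
(`profile_le_boundFactor`).

All estimates are uniform in the length of the chain.  With no impurities taken into account they
show that the finite-volume dynamics of a local observable form a Cauchy sequence
(`norm_heisenberg_succ_sub_le`); the on-site terms that are added with each new site commute with
everything in the interior, so their size plays no role.
-/

open SpinChain

namespace SpinChain

/-! ### Heisenberg dynamics -/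

section Dynamics

variable {D : ℕ}

noncomputable local instance : NormedAlgebra ℚ (Op D) := NormedAlgebra.restrictScalars ℚ ℂ (Op D)

lemma heisenberg_eq (H : Op D) (t : ℝ) (A : Op D) :
    heisenberg H t A = NormedSpace.exp ((t : ℂ) • (Complex.I • H)) * A *
      NormedSpace.exp (-((t : ℂ) • (Complex.I • H))) := by
  have h : (Complex.I * t) • H = (t : ℂ) • (Complex.I • H) := by
    rw [mul_comm, mul_smul]
  rw [heisenberg, neg_smul, h]

lemma exp_mul_exp_neg (x : Op D) : NormedSpace.exp x * NormedSpace.exp (-x) = 1 := by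
  rw [← NormedSpace.exp_add_of_commute (Commute.neg_right (Commute.refl x)), add_neg_cancel,
    NormedSpace.exp_zero]

lemma exp_neg_mul_exp (x : Op D) : NormedSpace.exp (-x) * NormedSpace.exp x = 1 := by
  simpa using exp_mul_exp_neg (-x)

lemma exp_smul_I_mem_unitary {H : Op D} (hH : IsSelfAdjoint H) (t : ℝ) :
    NormedSpace.exp ((t : ℂ) • (Complex.I • H)) ∈ unitary (Op D) := by
  apply NormedSpace.exp_mem_unitary_of_mem_skewAdjoint
  rw [skewAdjoint.mem_iff, star_smul, star_smul, hH.star_eq]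
  simp

lemma exp_neg_smul_I_mem_unitary {H : Op D} (hH : IsSelfAdjoint H) (t : ℝ) :
    NormedSpace.exp (-((t : ℂ) • (Complex.I • H))) ∈ unitary (Op D) := by
  simpa using exp_smul_I_mem_unitary hH (-t)

@[simp] lemma heisenberg_zero_time (H A : Op D) : heisenberg H 0 A = A := by
  simp [heisenberg_eq]

lemma heisenberg_add (H : Op D) (t : ℝ) (A B : Op D) :
    heisenberg H t (A + B) = heisenberg H t A + heisenberg H t B := by
  simp [heisenberg_eq, mul_add, add_mul]

lemma heisenberg_sub (H : Op D) (t : ℝ) (A B : Op D) :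
    heisenberg H t (A - B) = heisenberg H t A - heisenberg H t B := by
  simp [heisenberg_eq, mul_sub, sub_mul]

lemma heisenberg_smul (H : Op D) (t : ℝ) (c : ℂ) (A : Op D) :
    heisenberg H t (c • A) = c • heisenberg H t A := by
  simp [heisenberg_eq]

lemma heisenberg_mul (H : Op D) (t : ℝ) (A B : Op D) :
    heisenberg H t (A * B) = heisenberg H t A * heisenberg H t B := by
  simp only [heisenberg_eq]
  set u := (t : ℂ) • (Complex.I • H)
  calc _ = NormedSpace.exp u * A * 1 * B * NormedSpace.exp (-u) := by simp only [mul_one, mul_assoc]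
    _ = _ := by rw [← exp_neg_mul_exp u]; simp only [mul_assoc]

lemma heisenberg_opComm (H : Op D) (t : ℝ) (A B : Op D) :
    heisenberg H t (opComm A B) = opComm (heisenberg H t A) (heisenberg H t B) := by
  simp only [opComm, heisenberg_sub, heisenberg_mul]

lemma heisenberg_star {H : Op D} (hH : IsSelfAdjoint H) (t : ℝ) (A : Op D) :
    heisenberg H t (star A) = star (heisenberg H t A) := by
  have h : star ((t : ℂ) • (Complex.I • H)) = -((t : ℂ) • (Complex.I • H)) := by
    rw [star_smul, star_smul, hH.star_eq]
    simp
  simp only [heisenberg_eq, star_mul, NormedSpace.star_exp, star_neg, h, neg_neg, mul_assoc]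

lemma norm_heisenberg {H : Op D} (hH : IsSelfAdjoint H) (t : ℝ) (A : Op D) :
    ‖heisenberg H t A‖ = ‖A‖ := by
  rw [heisenberg_eq, CStarRing.norm_mul_mem_unitary _ (exp_neg_smul_I_mem_unitary hH t),
    CStarRing.norm_mem_unitary_mul _ (exp_smul_I_mem_unitary hH t)]

lemma heisenberg_neg_heisenberg (H : Op D) (t : ℝ) (A : Op D) :
    heisenberg H (-t) (heisenberg H t A) = A := by
  simp only [heisenberg_eq, Complex.ofReal_neg, neg_smul, neg_neg]
  set u := (t : ℂ) • (Complex.I • H)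
  calc _ = (NormedSpace.exp (-u) * NormedSpace.exp u) * A *
          (NormedSpace.exp (-u) * NormedSpace.exp u) := by
        simp only [mul_assoc]
    _ = A := by rw [exp_neg_mul_exp]; simp

lemma heisenberg_heisenberg_neg (H : Op D) (t : ℝ) (A : Op D) :
    heisenberg H t (heisenberg H (-t) A) = A := by
  simpa using heisenberg_neg_heisenberg H (-t) A

lemma heisenberg_neg (H : Op D) (t : ℝ) (A : Op D) :
    heisenberg (-H) t A = heisenberg H (-t) A := by
  simp [heisenberg_eq]

lemma commute_heisenberg {X H A : Op D} (h : Commute X H) (h' : Commute X A) (t : ℝ) :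
    Commute X (heisenberg H t A) := by
  rw [heisenberg_eq]
  have h1 : Commute X ((t : ℂ) • (Complex.I • H)) := (h.smul_right _).smul_right _
  exact ((h1.exp_right).mul_right h').mul_right h1.neg_right.exp_right

lemma heisenberg_of_commute {H A : Op D} (h : Commute H A) (t : ℝ) : heisenberg H t A = A := by
  rw [heisenberg_eq]
  have h1 : Commute ((t : ℂ) • (Complex.I • H)) A := (h.smul_left _).smul_left _
  rw [h1.exp_left.eq, mul_assoc, exp_mul_exp_neg, mul_one]

/-- Commuting parts of a Hamiltonian evolve separately. -/
lemma heisenberg_add_hamiltonian {H K : Op D} (h : Commute H K) (t : ℝ) (A : Op D) :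
    heisenberg (H + K) t A = heisenberg K t (heisenberg H t A) := by
  have h1 : Commute ((t : ℂ) • (Complex.I • K)) ((t : ℂ) • (Complex.I • H)) :=
    ((h.symm.smul_left _).smul_left _).smul_right _ |>.smul_right _ |> fun h => by simpa using h
  simp only [heisenberg_eq, smul_add, neg_add]
  rw [add_comm, NormedSpace.exp_add_of_commute h1,
    NormedSpace.exp_add_of_commute h1.symm.neg_left.neg_right]
  simp only [mul_assoc]

lemma heisenberg_exp (Q : Op D) (s : ℝ) (X : Op D) :
    heisenberg Q s (NormedSpace.exp X) = NormedSpace.exp (heisenberg Q s X) := by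
  let u : (Op D)ˣ := ⟨NormedSpace.exp ((s : ℂ) • (Complex.I • Q)),
    NormedSpace.exp (-((s : ℂ) • (Complex.I • Q))),
    exp_mul_exp_neg _, exp_neg_mul_exp _⟩
  have := NormedSpace.exp_units_conj u X
  simp only [heisenberg_eq]
  exact this.symm

/-- Passing to a rotated frame: the rotation `heisenberg Q s` intertwines the dynamics of `H`
with the dynamics of the rotated Hamiltonian. -/
lemma heisenberg_conj (Q : Op D) (s : ℝ) (H : Op D) (t : ℝ) (A : Op D) :
    heisenberg Q s (heisenberg H t A) = heisenberg (heisenberg Q s H) t (heisenberg Q s A) := by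
  have h : ∀ c : ℂ, heisenberg Q s (NormedSpace.exp (c • H)) =
      NormedSpace.exp (c • heisenberg Q s H) := fun c => by
    rw [heisenberg_exp, heisenberg_smul]
  rw [heisenberg.eq_1 H, heisenberg_mul, heisenberg_mul, h, h, ← heisenberg]

lemma isSelfAdjoint_heisenberg {H A : Op D} (hH : IsSelfAdjoint H) (hA : IsSelfAdjoint A) (t : ℝ) :
    IsSelfAdjoint (heisenberg H t A) := by
  rw [IsSelfAdjoint, ← heisenberg_star hH, hA.star_eq]

lemma hasDerivAt_exp_smul (K : Op D) (t : ℝ) :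
    HasDerivAt (fun s : ℝ => NormedSpace.exp ((s : ℂ) • K)) (NormedSpace.exp ((t : ℂ) • K) * K) t :=
  hasDerivAt_exp_smul_const K t

lemma hasDerivAt_exp_neg_smul (K : Op D) (t : ℝ) :
    HasDerivAt (fun s : ℝ => NormedSpace.exp (-((s : ℂ) • K)))
      (-(K * NormedSpace.exp (-((t : ℂ) • K)))) t := by
  have h : HasDerivAt (fun s : ℝ => NormedSpace.exp ((s : ℂ) • (-K)))
      ((-K) * NormedSpace.exp ((t : ℂ) • (-K))) t := hasDerivAt_exp_smul_const' (𝕂 := ℝ) (-K) t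
  simp only [smul_neg, neg_mul] at h
  exact h

/-- Differentiating a Heisenberg evolution whose argument also depends on time. -/
lemma hasDerivAt_heisenberg (H : Op D) {f : ℝ → Op D} {f' : Op D} {t : ℝ}
    (hf : HasDerivAt f f' t) :
    HasDerivAt (fun s => heisenberg H s (f s))
      (heisenberg H t (Complex.I • opComm H (f t) + f')) t := by
  simp only [heisenberg_eq]
  set K := Complex.I • H with hK
  have h := ((hasDerivAt_exp_smul K t).mul hf).mul (hasDerivAt_exp_neg_smul K t)
  refine h.congr_deriv ?_
  have h2 : Complex.I • opComm H (f t) = K * f t - f t * K := by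
    simp [hK, opComm, smul_sub]
  rw [h2]
  simp only [Pi.mul_apply]
  noncomm_ring

lemma norm_opComm_le (A B : Op D) : ‖opComm A B‖ ≤ 2 * ‖A‖ * ‖B‖ := by
  calc ‖opComm A B‖ ≤ ‖A * B‖ + ‖B * A‖ := norm_sub_le _ _
    _ ≤ ‖A‖ * ‖B‖ + ‖B‖ * ‖A‖ := add_le_add (norm_mul_le _ _) (norm_mul_le _ _)
    _ = _ := by ring

lemma norm_opComm_comm (A B : Op D) : ‖opComm A B‖ = ‖opComm B A‖ := by
  rw [opComm, opComm, norm_sub_rev]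

lemma opComm_add_left (A B C : Op D) : opComm (A + B) C = opComm A C + opComm B C := by
  simp only [opComm]; noncomm_ring

lemma opComm_sub_right (A B C : Op D) : opComm A (B - C) = opComm A B - opComm A C := by
  simp only [opComm]; noncomm_ring

lemma opComm_eq_zero {A B : Op D} (h : Commute A B) : opComm A B = 0 := sub_eq_zero.2 h.eq

lemma norm_opComm_heisenberg {H : Op D} (hH : IsSelfAdjoint H) (t : ℝ) (A B : Op D) :
    ‖opComm (heisenberg H t A) B‖ = ‖opComm A (heisenberg H (-t) B)‖ := by
  rw [← norm_heisenberg hH (-t) (opComm _ B), heisenberg_opComm, heisenberg_neg_heisenberg]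

/-- Mean value inequality with a majorant, forward in time. -/
lemma norm_heisenberg_sub_le_of_nonneg {H H₀ : Op D} (hH : IsSelfAdjoint H)
    (hH₀ : IsSelfAdjoint H₀) (B : Op D) {g g' : ℝ → ℝ} (hg : ∀ s, HasDerivAt g (g' s) s)
    (hg0 : 0 ≤ g 0) {t : ℝ} (ht : 0 ≤ t)
    (hb : ∀ s, 0 ≤ s → s ≤ t → ‖opComm (heisenberg H s (H - H₀)) B‖ ≤ g' s) :
    ‖heisenberg H (-t) B - heisenberg H₀ (-t) B‖ ≤ g t := by
  -- In the interaction picture only the perturbation `H - H₀` drives the motion of `B`.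
  set f : ℝ → Op D := fun s => heisenberg H₀ s (heisenberg (-H) s B) - B with hf
  have hder : ∀ s, HasDerivAt f
      (heisenberg H₀ s (Complex.I • opComm (H₀ - H) (heisenberg (-H) s B))) s := by
    intro s
    have h1 := hasDerivAt_heisenberg (-H) (hasDerivAt_const s B)
    have h2 := (hasDerivAt_heisenberg H₀ h1).sub_const B
    refine h2.congr_deriv ?_
    have hc : heisenberg (-H) s (opComm (-H) B) = opComm (-H) (heisenberg (-H) s B) := by
      rw [heisenberg_opComm, heisenberg_of_commute (Commute.refl (-H))]
    rw [add_zero, heisenberg_smul, hc, ← smul_add, ← opComm_add_left, sub_eq_add_neg H₀]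
  have hft : ‖f t‖ = ‖heisenberg H (-t) B - heisenberg H₀ (-t) B‖ := by
    rw [← norm_heisenberg hH₀ (-t) (f t)]
    simp only [hf]
    rw [heisenberg_sub, heisenberg_neg_heisenberg, heisenberg_neg]
  rw [← hft]
  refine image_norm_le_of_norm_deriv_right_le_deriv_boundary (a := 0) (b := t)
    (fun s _ => (hder s).continuousAt.continuousWithinAt)
    (fun s _ => (hder s).hasDerivWithinAt) (B := g) (B' := g') (by simpa [hf] using hg0) hg ?_
    ⟨ht, le_rfl⟩
  intro s hs
  rw [norm_heisenberg hH₀, norm_smul, Complex.norm_I, one_mul, heisenberg_neg]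
  refine le_trans (le_of_eq ?_) (hb s hs.1 hs.2.le)
  rw [norm_opComm_heisenberg hH, ← neg_sub H H₀, opComm, opComm, ← norm_neg]
  congr 1
  noncomm_ring

/-- Duhamel bound: two dynamics of `B` differ by at most the time integral of the commutator of
`B` with the evolved perturbation. -/
lemma norm_heisenberg_sub_le {H H₀ : Op D} (hH : IsSelfAdjoint H)
    (hH₀ : IsSelfAdjoint H₀) (B : Op D) {g g' : ℝ → ℝ} (hg : ∀ s, HasDerivAt g (g' s) s)
    (hg0 : 0 ≤ g 0) (t : ℝ)
    (hb : ∀ s, |s| ≤ |t| → ‖opComm (heisenberg H s (H - H₀)) B‖ ≤ g' |s|) :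
    ‖heisenberg H (-t) B - heisenberg H₀ (-t) B‖ ≤ g |t| := by
  rcases le_total 0 t with ht | ht
  · rw [abs_of_nonneg ht] at hb ⊢
    refine norm_heisenberg_sub_le_of_nonneg hH hH₀ B hg hg0 ht fun s hs hst => ?_
    simpa [abs_of_nonneg hs] using hb s (by rwa [abs_of_nonneg hs])
  · rw [abs_of_nonpos ht] at hb ⊢
    have := norm_heisenberg_sub_le_of_nonneg hH.neg hH₀.neg B hg hg0 (t := -t) (by linarith)
      fun s hs hst => by
        have h := hb (-s) (by rwa [abs_neg, abs_of_nonneg hs])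
        rw [abs_neg, abs_of_nonneg hs] at h
        rw [heisenberg_neg, ← neg_sub', ← norm_neg]
        refine le_of_eq_of_le ?_ h
        congr 1
        simp only [neg_sub, heisenberg_sub, opComm]
        noncomm_ring
    simpa only [heisenberg_neg, neg_neg] using this

/-- If the dynamics of `H₀` does not carry `A` to `B`, then transport under `H` is controlled by the
transport of the remaining term `H - H₀`. -/
lemma norm_opComm_heisenberg_le {H H₀ : Op D} (hH : IsSelfAdjoint H)
    (hH₀ : IsSelfAdjoint H₀) {A B : Op D} {g g' : ℝ → ℝ} (hg : ∀ s, HasDerivAt g (g' s) s)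
    (hg0 : 0 ≤ g 0) (t : ℝ) (h₀ : Commute A (heisenberg H₀ (-t) B))
    (hb : ∀ s, |s| ≤ |t| → ‖opComm (heisenberg H s (H - H₀)) B‖ ≤ g' |s|) :
    ‖opComm (heisenberg H t A) B‖ ≤ 2 * ‖A‖ * g |t| := by
  rw [norm_opComm_heisenberg hH]
  have h := norm_heisenberg_sub_le hH hH₀ B hg hg0 t hb
  have h2 : opComm A (heisenberg H (-t) B)
      = opComm A (heisenberg H (-t) B - heisenberg H₀ (-t) B) := by
    rw [opComm_sub_right, opComm_eq_zero h₀, sub_zero]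
  rw [h2]
  refine (norm_opComm_le _ _).trans ?_
  gcongr

lemma norm_heisenberg_one_sub_le {Q : Op D} (hQ : IsSelfAdjoint Q) (Y : Op D) :
    ‖heisenberg Q 1 Y - Y‖ ≤ ‖opComm Q Y‖ := by
  have hder : ∀ s, HasDerivAt (fun s => heisenberg Q s Y)
      (heisenberg Q s (Complex.I • opComm Q Y + 0)) s := fun s =>
    hasDerivAt_heisenberg Q (hasDerivAt_const s Y)
  have := norm_image_sub_le_of_norm_deriv_le_segment_01' (f := fun s => heisenberg Q s Y)
    (C := ‖opComm Q Y‖) (fun s _ => (hder s).hasDerivWithinAt) (fun s _ => by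
      rw [norm_heisenberg hQ, add_zero, norm_smul, Complex.norm_I, one_mul])
  simpa using this

lemma norm_heisenberg_sub_self_le {Q : Op D} (hQ : IsSelfAdjoint Q) (Y : Op D) {s : ℝ}
    (hs : 0 ≤ s) (hs1 : s ≤ 1) : ‖heisenberg Q s Y - Y‖ ≤ ‖opComm Q Y‖ := by
  have hder : ∀ s, HasDerivAt (fun s => heisenberg Q s Y)
      (heisenberg Q s (Complex.I • opComm Q Y + 0)) s := fun s =>
    hasDerivAt_heisenberg Q (hasDerivAt_const s Y)
  have := norm_image_sub_le_of_norm_deriv_le_segment' (f := fun s => heisenberg Q s Y) (a := 0)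
    (b := 1) (C := ‖opComm Q Y‖) (fun s _ => (hder s).hasDerivWithinAt) (fun s _ => by
      rw [norm_heisenberg hQ, add_zero, norm_smul, Complex.norm_I, one_mul]) s ⟨hs, hs1⟩
  simp only [heisenberg_zero_time, sub_zero] at this
  exact this.trans (mul_le_of_le_one_right (norm_nonneg _) hs1)

/-- If the rotation generated by `Q` cancels `W` from `v + W` to first order, then only a second
order term remains. -/
lemma norm_heisenberg_sub_add_le {Q v W : Op D} (hQ : IsSelfAdjoint Q)
    (h : Complex.I • opComm Q v = -W) : ‖heisenberg Q 1 v - v + W‖ ≤ ‖opComm Q W‖ := by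
  have hder : ∀ s : ℝ, HasDerivAt (fun s : ℝ => heisenberg Q s v + s • W)
      (W - heisenberg Q s W) s := fun s => by
    have h1 := (hasDerivAt_heisenberg Q (hasDerivAt_const s v)).add
      ((hasDerivAt_id s).smul_const W)
    refine h1.congr_deriv ?_
    rw [add_zero, h, one_smul, ← zero_sub W, heisenberg_sub]
    simp [heisenberg_eq, sub_eq_add_neg, add_comm]
  have := norm_image_sub_le_of_norm_deriv_le_segment_01'
    (f := fun s : ℝ => heisenberg Q s v + s • W)
    (C := ‖opComm Q W‖) (fun s _ => (hder s).hasDerivWithinAt) (fun s hs => by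
      rw [norm_sub_rev]
      exact norm_heisenberg_sub_self_le hQ W hs.1 hs.2.le)
  refine le_of_eq_of_le (congrArg norm ?_) this
  rw [heisenberg_zero_time, one_smul, zero_smul, add_zero]
  abel

end Dynamics

/-! ### Locality -/

section Locality

variable {D : ℕ}

lemma replace_comm {X Y : Finset ℤ} (h : Disjoint X Y) (η : X → Fin D) (ζ : Y → Fin D)
    (σ : Config D) : replace X η (replace Y ζ σ) = replace Y ζ (replace X η σ) := by
  funext x
  by_cases hx : x ∈ X
  · have hy : x ∉ Y := Finset.disjoint_left.1 h hx
    simp [replace, hx, hy]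
  · by_cases hy : x ∈ Y <;> simp [replace, hx, hy]

lemma restrict_replace_of_disjoint {X Y : Finset ℤ} (h : Disjoint X Y) (η : X → Fin D)
    (σ : Config D) : Y.restrict (replace X η σ) = Y.restrict σ := by
  funext y
  have hy : (y : ℤ) ∉ X := Finset.disjoint_right.1 h y.2
  simp [replace, hy]

lemma commute_localOp {X Y : Finset ℤ} (h : Disjoint X Y) (M : LocalMatrix D X)
    (N : LocalMatrix D Y) : Commute (localOp X M) (localOp Y N) := by
  ext ψ σ
  simp only [mul_apply_eq_comp, localOp_apply, restrict_replace_of_disjoint h,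
    restrict_replace_of_disjoint h.symm, Finset.mul_sum]
  rw [Finset.sum_comm]
  refine Finset.sum_congr rfl fun ζ _ => Finset.sum_congr rfl fun η _ => ?_
  rw [replace_comm h]
  ring

/-- Observables on disjoint sets of sites commute. -/
lemma commute_of_disjoint {X Y : Finset ℤ} (h : Disjoint X Y) {A B : Op D}
    (hA : A ∈ siteAlgebra D X) (hB : B ∈ siteAlgebra D Y) : Commute A B := by
  obtain ⟨M, rfl⟩ := hA
  obtain ⟨N, rfl⟩ := hB
  exact commute_localOp h M N

lemma localOp_single_union {X Y : Finset ℤ} (h : Disjoint X Y) (ξ η : (X ∪ Y : Finset ℤ) → Fin D) :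
    localOp (X ∪ Y) (Matrix.single ξ η 1) =
      localOp X (Matrix.single (fun x => ξ ⟨x, Finset.mem_union_left Y x.2⟩)
        (fun x => η ⟨x, Finset.mem_union_left Y x.2⟩) 1) *
      localOp Y (Matrix.single (fun y => ξ ⟨y, Finset.mem_union_right X y.2⟩)
        (fun y => η ⟨y, Finset.mem_union_right X y.2⟩) 1) := by
  ext ψ σ
  simp only [mul_apply_eq_comp, localOp_apply, restrict_replace_of_disjoint h]
  rw [Finset.sum_eq_single η (fun ζ _ hζ => by simp [hζ.symm]) (by simp),
    Finset.sum_eq_single (fun x : X => η ⟨x, Finset.mem_union_left Y x.2⟩)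
      (fun ζ _ hζ => by simp [Matrix.single_apply, hζ.symm]) (by simp),
    Finset.sum_eq_single (fun y : Y => η ⟨y, Finset.mem_union_right X y.2⟩)
      (fun ζ _ hζ => by simp [hζ.symm]) (by simp)]
  have h1 : replace (X ∪ Y) η σ = replace Y (fun y => η ⟨y, Finset.mem_union_right X y.2⟩)
      (replace X (fun x => η ⟨x, Finset.mem_union_left Y x.2⟩) σ) := by
    funext x
    by_cases hy : x ∈ Y
    · simp [replace, hy]
    · by_cases hx : x ∈ X <;> simp [replace, hx, hy]
  have h2 : ξ = (X ∪ Y).restrict σ ↔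
      (fun x : X => ξ ⟨x, Finset.mem_union_left Y x.2⟩) = X.restrict σ ∧
      (fun y : Y => ξ ⟨y, Finset.mem_union_right X y.2⟩) = Y.restrict σ := by
    constructor
    · rintro rfl
      exact ⟨rfl, rfl⟩
    · rintro ⟨hx, hy⟩
      funext ⟨z, hz⟩
      rcases Finset.mem_union.1 hz with hz' | hz'
      · exact congrFun hx ⟨z, hz'⟩
      · exact congrFun hy ⟨z, hz'⟩
  rw [h1]
  simp only [Matrix.single_apply, and_true]
  by_cases ha : (fun x : X => ξ ⟨x, Finset.mem_union_left Y x.2⟩) = X.restrict σ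
  · by_cases hb : (fun y : Y => ξ ⟨y, Finset.mem_union_right X y.2⟩) = Y.restrict σ
    · rw [if_pos (h2.2 ⟨ha, hb⟩), if_pos ha, if_pos hb]
      ring
    · rw [if_neg (fun hh => hb (h2.1 hh).2), if_neg hb]
      ring
  · rw [if_neg (fun hh => ha (h2.1 hh).1), if_neg ha]
    ring

/-- `𝒜_{X ∪ Y}` is generated by `𝒜_X` and `𝒜_Y`, as far as commutants are concerned. -/
lemma commute_union {X Y : Finset ℤ} (h : Disjoint X Y) {T : Op D}
    (hX : ∀ C ∈ siteAlgebra D X, Commute T C) (hY : ∀ C ∈ siteAlgebra D Y, Commute T C) :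
    ∀ C ∈ siteAlgebra D (X ∪ Y), Commute T C := by
  rintro _ ⟨M, rfl⟩
  rw [Matrix.matrix_eq_sum_single M]
  change Commute T (localHom D (X ∪ Y) _)
  simp only [map_sum]
  refine Commute.sum_right _ _ _ fun ξ _ => Commute.sum_right _ _ _ fun η _ => ?_
  rw [show Matrix.single ξ η (M ξ η) = M ξ η • Matrix.single ξ η 1 by simp, map_smul]
  refine Commute.smul_right ?_ _
  change Commute T (localOp (X ∪ Y) _)
  rw [localOp_single_union h]
  exact (hX _ ⟨_, rfl⟩).mul_right (hY _ ⟨_, rfl⟩)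

/-- `A` commutes with all observables on sites to the right of `y`: the operator `A` acts on the
half-line `(-∞, y]`. -/
def IsLeftOf (A : Op D) (y : ℤ) : Prop :=
  ∀ X : Finset ℤ, (∀ z ∈ X, y < z) → ∀ C ∈ siteAlgebra D X, Commute A C

lemma IsLeftOf.mono {A : Op D} {y y' : ℤ} (h : IsLeftOf A y) (hy : y ≤ y') : IsLeftOf A y' :=
  fun X hX => h X fun z hz => hy.trans_lt (hX z hz)

lemma isLeftOf_of_mem {A : Op D} {X : Finset ℤ} {y : ℤ} (hA : A ∈ siteAlgebra D X)
    (hX : ∀ z ∈ X, z ≤ y) : IsLeftOf A y := fun _ hY _ hC =>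
  commute_of_disjoint (Finset.disjoint_left.2 fun z hz hz' =>
    absurd (hX z hz) (not_le.2 (hY z hz'))) hA hC

lemma IsLeftOf.add {A B : Op D} {y : ℤ} (hA : IsLeftOf A y) (hB : IsLeftOf B y) :
    IsLeftOf (A + B) y := fun X hX C hC => (hA X hX C hC).add_left (hB X hX C hC)

lemma IsLeftOf.sub {A B : Op D} {y : ℤ} (hA : IsLeftOf A y) (hB : IsLeftOf B y) :
    IsLeftOf (A - B) y := fun X hX C hC => (hA X hX C hC).sub_left (hB X hX C hC)

lemma IsLeftOf.heisenberg {H A : Op D} {y : ℤ} (hH : IsLeftOf H y) (hA : IsLeftOf A y) (t : ℝ) :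
    IsLeftOf (heisenberg H t A) y := fun X hX C hC =>
  (commute_heisenberg (hH X hX C hC).symm (hA X hX C hC).symm t).symm

/-- The identification of `D × D` matrices with `𝒜_{{x}}`. -/
def siteEquiv (D : ℕ) (x : ℤ) : (({x} : Finset ℤ) → Fin D) ≃ Fin D where
  toFun ξ := ξ ⟨x, by simp⟩
  invFun i := fun _ => i
  left_inv ξ := by
    funext ⟨z, hz⟩
    obtain rfl := Finset.mem_singleton.1 hz
    rfl
  right_inv _ := rfl

lemma onSite_eq (x : ℤ) (M : Matrix (Fin D) (Fin D) ℂ) :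
    onSite x M = localHom D {x} (M.submatrix (siteEquiv D x) (siteEquiv D x)) := rfl

lemma onSite_mem (x : ℤ) (M : Matrix (Fin D) (Fin D) ℂ) : onSite x M ∈ siteAlgebra D {x} :=
  ⟨_, rfl⟩

lemma exists_onSite {x : ℤ} {C : Op D} (hC : C ∈ siteAlgebra D {x}) : ∃ M, onSite x M = C := by
  obtain ⟨M, rfl⟩ := hC
  refine ⟨M.submatrix (siteEquiv D x).symm (siteEquiv D x).symm, ?_⟩
  rw [onSite_eq]
  simp

lemma onSite_mul (x : ℤ) (M N : Matrix (Fin D) (Fin D) ℂ) :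
    onSite x (M * N) = onSite x M * onSite x N := by
  simp only [onSite_eq, ← map_mul, Matrix.submatrix_mul_equiv]

lemma onSite_one (x : ℤ) : onSite x (1 : Matrix (Fin D) (Fin D) ℂ) = 1 := by
  simp [onSite_eq]

lemma onSite_star (x : ℤ) (M : Matrix (Fin D) (Fin D) ℂ) :
    onSite x (star M) = star (onSite x M) := by
  simp only [onSite_eq, ← map_star]
  rfl

lemma onSite_smul (x : ℤ) (c : ℂ) (M : Matrix (Fin D) (Fin D) ℂ) :
    onSite x (c • M) = c • onSite x M := by
  simp only [onSite_eq, ← map_smul]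
  rfl

lemma onSite_zero (x : ℤ) : onSite x (0 : Matrix (Fin D) (Fin D) ℂ) = 0 := by
  simp [onSite_eq]

lemma onSite_sum {ι : Type*} (x : ℤ) (s : Finset ι) (M : ι → Matrix (Fin D) (Fin D) ℂ) :
    onSite x (∑ i ∈ s, M i) = ∑ i ∈ s, onSite x (M i) := by
  simp only [onSite_eq, ← map_sum]
  congr 1
  ext ξ η
  simp [Matrix.sum_apply]

end Locality

/-! ### Matrix units of an impurity -/

section Impurity

variable {D : ℕ} {M : Matrix (Fin D) (Fin D) ℂ}

/-- The matrix unit `|u_i⟩⟨u_j|` at the site `x`, where `u_1, …, u_D` is the orthonormal eigenbasis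
of the Hermitian matrix `M`. -/
noncomputable def siteUnit (hM : M.IsHermitian) (x : ℤ) (i j : Fin D) : Op D :=
  onSite x ((hM.eigenvectorUnitary : Matrix (Fin D) (Fin D) ℂ) * Matrix.single i j 1 *
    star (hM.eigenvectorUnitary : Matrix (Fin D) (Fin D) ℂ))

variable (hM : M.IsHermitian) (x : ℤ)

lemma siteUnit_mem (i j : Fin D) : siteUnit hM x i j ∈ siteAlgebra D {x} := onSite_mem _ _

lemma star_eigenvectorUnitary_mul_self :
    star (hM.eigenvectorUnitary : Matrix (Fin D) (Fin D) ℂ) *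
      (hM.eigenvectorUnitary : Matrix (Fin D) (Fin D) ℂ) = 1 :=
  Unitary.coe_star_mul_self _

lemma eigenvectorUnitary_mul_star_self :
    (hM.eigenvectorUnitary : Matrix (Fin D) (Fin D) ℂ) *
      star (hM.eigenvectorUnitary : Matrix (Fin D) (Fin D) ℂ) = 1 :=
  Unitary.coe_mul_star_self _

lemma siteUnit_mul (i j k l : Fin D) :
    siteUnit hM x i j * siteUnit hM x k l = if j = k then siteUnit hM x i l else 0 := by
  rw [siteUnit, siteUnit, ← onSite_mul]
  set U := (hM.eigenvectorUnitary : Matrix (Fin D) (Fin D) ℂ)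
  have h : U * Matrix.single i j 1 * star U * (U * Matrix.single k l 1 * star U) =
      U * (Matrix.single i j 1 * Matrix.single k l 1) * star U := by
    calc _ = U * Matrix.single i j 1 * (star U * U) * Matrix.single k l 1 * star U := by
          simp only [mul_assoc]
      _ = _ := by rw [star_eigenvectorUnitary_mul_self, mul_one, mul_assoc U]
  rw [h]
  split_ifs with hjk
  · subst hjk
    rw [Matrix.single_mul_single_same, one_mul, siteUnit]
  · rw [Matrix.single_mul_single_of_ne _ _ _ _ hjk]
    simp [onSite_zero]

lemma siteUnit_star (i j : Fin D) : star (siteUnit hM x i j) = siteUnit hM x j i := by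
  rw [siteUnit, ← onSite_star, star_mul, star_mul, star_star, ← mul_assoc, siteUnit]
  congr 3
  simp [Matrix.star_eq_conjTranspose]

lemma sum_smul_siteUnit (c : Fin D → Fin D → ℂ) :
    ∑ i, ∑ j, c i j • siteUnit hM x i j =
      onSite x ((hM.eigenvectorUnitary : Matrix (Fin D) (Fin D) ℂ) * Matrix.of c *
        star (hM.eigenvectorUnitary : Matrix (Fin D) (Fin D) ℂ)) := by
  simp only [siteUnit, ← onSite_smul, ← onSite_sum]
  congr 1
  rw [Matrix.matrix_eq_sum_single (Matrix.of c)]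
  simp only [Finset.mul_sum, Finset.sum_mul]
  refine Finset.sum_congr rfl fun i _ => Finset.sum_congr rfl fun j _ => ?_
  rw [Matrix.of_apply, show Matrix.single i j (c i j) = c i j • Matrix.single i j 1 by simp,
    mul_smul_comm, smul_mul_assoc]

lemma sum_smul_siteUnit_diag (c : Fin D → ℂ) :
    ∑ i, c i • siteUnit hM x i i =
      onSite x ((hM.eigenvectorUnitary : Matrix (Fin D) (Fin D) ℂ) * Matrix.diagonal c *
        star (hM.eigenvectorUnitary : Matrix (Fin D) (Fin D) ℂ)) := by
  have h := sum_smul_siteUnit hM x (Matrix.diagonal c)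
  rw [show Matrix.of (Matrix.diagonal c) = Matrix.diagonal c from rfl] at h
  rw [← h]
  refine Finset.sum_congr rfl fun i _ => ?_
  rw [Finset.sum_eq_single i (fun j _ hj => by simp [Matrix.diagonal_apply_ne' _ hj]) (by simp),
    Matrix.diagonal_apply_eq]

lemma sum_siteUnit : ∑ i, siteUnit hM x i i = 1 := by
  have h := sum_smul_siteUnit_diag hM x fun _ => 1
  simpa [eigenvectorUnitary_mul_star_self, onSite_one] using h

lemma sum_eigenvalues_smul_siteUnit :
    ∑ i, (hM.eigenvalues i : ℂ) • siteUnit hM x i i = onSite x M := by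
  rw [sum_smul_siteUnit_diag]
  congr 1
  conv_rhs => rw [hM.spectral_theorem]
  rfl

/-- The matrix units at `x` span `𝒜_{{x}}`. -/
lemma commute_of_commute_siteUnit {T : Op D} (h : ∀ i j, Commute T (siteUnit hM x i j)) :
    ∀ C ∈ siteAlgebra D {x}, Commute T C := by
  intro C hC
  obtain ⟨N, rfl⟩ := exists_onSite hC
  set U := (hM.eigenvectorUnitary : Matrix (Fin D) (Fin D) ℂ) with hU
  have hN : N = U * Matrix.of (fun i j => (star U * N * U) i j) * star U := by
    calc N = (U * star U) * N * (U * star U) := by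
          rw [eigenvectorUnitary_mul_star_self, one_mul, mul_one]
      _ = U * (star U * N * U) * star U := by simp only [mul_assoc]
      _ = _ := rfl
  rw [hN, hU, ← sum_smul_siteUnit]
  exact Commute.sum_right _ _ _ fun i _ => Commute.sum_right _ _ _ fun j _ => (h i j).smul_right _

lemma norm_siteUnit_diag_le (i : Fin D) : ‖siteUnit hM x i i‖ ≤ 1 :=
  IsStarProjection.norm_le _ ⟨by rw [IsIdempotentElem, siteUnit_mul, if_pos rfl], siteUnit_star ..⟩

/-- The block-diagonal part `∑ᵢ Pᵢ X Pᵢ` of `X` with respect to the spectral projections `Pᵢ` of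
`M` at the site `x`. -/
noncomputable def pinch (X : Op D) : Op D := ∑ i, siteUnit hM x i i * X * siteUnit hM x i i

/-- The block `⟨u_k| h |u_k⟩` of `h`, an operator that acts trivially at the site `x`. -/
noncomputable def block (h : Op D) (k : Fin D) : Op D :=
  ∑ l, siteUnit hM x l k * h * siteUnit hM x k l

lemma siteUnit_mul_block (h : Op D) (i j k : Fin D) :
    siteUnit hM x i j * block hM x h k = siteUnit hM x i k * h * siteUnit hM x k j := by
  simp only [block, Finset.mul_sum, ← mul_assoc, siteUnit_mul, ite_mul, zero_mul]
  simp

lemma block_mul_siteUnit (h : Op D) (i j k : Fin D) :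
    block hM x h k * siteUnit hM x i j = siteUnit hM x i k * h * siteUnit hM x k j := by
  simp only [block, Finset.sum_mul, mul_assoc, siteUnit_mul, mul_ite, mul_zero]
  simp

lemma commute_block_siteUnit (h : Op D) (i j k : Fin D) :
    Commute (block hM x h k) (siteUnit hM x i j) := by
  rw [Commute, SemiconjBy, siteUnit_mul_block, block_mul_siteUnit]

lemma pinch_eq_sum_block (h : Op D) : pinch hM x h = ∑ k, siteUnit hM x k k * block hM x h k :=
  Finset.sum_congr rfl fun k _ => (siteUnit_mul_block hM x h k k k).symm

lemma commute_block {T h : Op D} (hT : Commute T h) (hT' : ∀ i j, Commute T (siteUnit hM x i j))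
    (k : Fin D) : Commute T (block hM x h k) :=
  Commute.sum_right _ _ _ fun _ _ => ((hT' _ _).mul_right hT).mul_right (hT' _ _)

lemma commute_pinch {T h : Op D} (hT : Commute T h) (hT' : ∀ i j, Commute T (siteUnit hM x i j)) :
    Commute T (pinch hM x h) :=
  Commute.sum_right _ _ _ fun _ _ => ((hT' _ _).mul_right hT).mul_right (hT' _ _)

/-- Couplings of the site `x` to its left and to its right commute once they have been made
block-diagonal: the blocks are one-dimensional at `x`, hence they are products over the two sides.
This is where nondegeneracy of the impurity matters. -/
lemma commute_pinch_pinch {X Y : Finset ℤ} (hY : x ∉ Y) (hXY : Disjoint X Y)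
    {h h' : Op D} (hh : h ∈ siteAlgebra D (X ∪ {x})) (hh' : h' ∈ siteAlgebra D ({x} ∪ Y)) :
    Commute (pinch hM x h) (pinch hM x h') := by
  have key : ∀ k, Commute (block hM x h k) h' := by
    intro k
    refine commute_union (by simpa using hY) ?_ ?_ h' hh'
    · exact commute_of_commute_siteUnit hM x fun i j => commute_block_siteUnit hM x h i j k
    · intro C hC
      refine (commute_block hM x ?_ (fun i j => ?_) k).symm
      · exact (commute_of_disjoint (by simp [hXY, hY]) hh hC).symm
      · exact (commute_of_disjoint (by simpa using hY) (siteUnit_mem hM x i j) hC).symm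
  rw [pinch_eq_sum_block hM x h]
  refine Commute.sum_left _ _ _ fun k _ => ?_
  rw [pinch_eq_sum_block hM x h']
  refine Commute.sum_right _ _ _ fun l _ => ?_
  have h1 : Commute (siteUnit hM x k k) (siteUnit hM x l l) := by
    rw [Commute, SemiconjBy, siteUnit_mul, siteUnit_mul]
    by_cases hkl : k = l
    · subst hkl; rfl
    · rw [if_neg hkl, if_neg (Ne.symm hkl)]
  exact (h1.mul_right (commute_block_siteUnit hM x h' k k l).symm).mul_left
    ((commute_block_siteUnit hM x h l l k).mul_right
      (commute_block hM x (key k) (fun i j => commute_block_siteUnit hM x h i j k) l))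

lemma sub_pinch_eq (X : Op D) : X - pinch hM x X =
    ∑ i, ∑ j, if i = j then 0 else siteUnit hM x i i * X * siteUnit hM x j j := by
  have h : X = ∑ i, ∑ j, siteUnit hM x i i * X * siteUnit hM x j j := by
    simp only [← Finset.mul_sum, ← Finset.sum_mul, sum_siteUnit, one_mul, mul_one]
  rw [show X - pinch hM x X = (∑ i, ∑ j, siteUnit hM x i i * X * siteUnit hM x j j) -
    pinch hM x X by rw [← h], pinch, ← Finset.sum_sub_distrib]
  refine Finset.sum_congr rfl fun i _ => ?_
  rw [sub_eq_iff_eq_add, ← Finset.sum_erase_add _ _ (Finset.mem_univ i)]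
  congr 1
  refine Finset.sum_subset_zero_on_sdiff (Finset.erase_subset _ _) (fun j hj => ?_)
    fun j hj => (if_neg (Finset.ne_of_mem_erase hj).symm).symm
  have hj' : i = j := by
    by_contra hne
    exact (Finset.mem_sdiff.1 hj).2 (Finset.mem_erase.2 ⟨Ne.symm hne, Finset.mem_univ j⟩)
  exact if_pos hj'

lemma isSelfAdjoint_pinch {X : Op D} (hX : IsSelfAdjoint X) : IsSelfAdjoint (pinch hM x X) := by
  rw [IsSelfAdjoint, pinch, star_sum]
  exact Finset.sum_congr rfl fun i _ => by
    rw [star_mul, star_mul, siteUnit_star, hX.star_eq, mul_assoc]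

lemma pinch_add (X Y : Op D) : pinch hM x (X + Y) = pinch hM x X + pinch hM x Y := by
  simp only [pinch, mul_add, add_mul, Finset.sum_add_distrib]

lemma norm_siteUnit_mul_mul_le (X : Op D) (i j : Fin D) :
    ‖siteUnit hM x i i * X * siteUnit hM x j j‖ ≤ ‖X‖ := by
  calc ‖siteUnit hM x i i * X * siteUnit hM x j j‖
      ≤ ‖siteUnit hM x i i‖ * ‖X‖ * ‖siteUnit hM x j j‖ := by
        refine (norm_mul_le _ _).trans ?_
        gcongr
        exact norm_mul_le _ _
    _ ≤ 1 * ‖X‖ * 1 := by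
        gcongr
        exacts [norm_siteUnit_diag_le hM x i, norm_siteUnit_diag_le hM x j]
    _ = ‖X‖ := by ring

lemma sum_offDiag_const (D : ℕ) (c : ℝ) :
    ∑ i : Fin D, ∑ j : Fin D, (if i = j then 0 else c) = 2 * (D.choose 2 : ℝ) * c := by
  have h : ∀ i : Fin D, ∑ j : Fin D, (if i = j then 0 else c) = ((D : ℝ) - 1) * c := by
    intro i
    have h1 : ∀ j : Fin D, (if i = j then 0 else c) = c - if i = j then c else 0 := fun j => by
      split_ifs <;> simp
    simp only [h1, Finset.sum_sub_distrib]
    simp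
    ring
  simp only [h, Finset.sum_const, Finset.card_univ, Fintype.card_fin, nsmul_eq_mul]
  rw [Nat.cast_choose_two]
  ring

lemma norm_sub_pinch_le (X : Op D) : ‖X - pinch hM x X‖ ≤ 2 * (D.choose 2 : ℝ) * ‖X‖ := by
  rw [sub_pinch_eq, ← sum_offDiag_const]
  refine (norm_sum_le _ _).trans (Finset.sum_le_sum fun i _ => (norm_sum_le _ _).trans
    (Finset.sum_le_sum fun j _ => ?_))
  split_ifs with h
  · simp
  · exact norm_siteUnit_mul_mul_le hM x X i j

/-- The generator of the rotation that removes the off-diagonal part of `X` to first order in the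
inverse impurity strength `1 / l`: the solution `Q` of `i [Q, l M] = -(X - pinch X)`.  The diagonal
coefficients are `0⁻¹ = 0`. -/
noncomputable def rotor (l : ℝ) (X : Op D) : Op D :=
  ∑ i, ∑ j, (-Complex.I * ((l * (hM.eigenvalues i - hM.eigenvalues j))⁻¹ : ℝ)) •
    (siteUnit hM x i i * X * siteUnit hM x j j)

lemma isSelfAdjoint_rotor (l : ℝ) {X : Op D} (hX : IsSelfAdjoint X) :
    IsSelfAdjoint (rotor hM x l X) := by
  rw [IsSelfAdjoint, rotor, star_sum]
  simp only [star_sum, star_smul, star_mul, siteUnit_star, hX.star_eq, ← mul_assoc]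
  rw [Finset.sum_comm]
  refine Finset.sum_congr rfl fun i _ => Finset.sum_congr rfl fun j _ => ?_
  congr 1
  have h : (l * (hM.eigenvalues i - hM.eigenvalues j))⁻¹ =
      -(l * (hM.eigenvalues j - hM.eigenvalues i))⁻¹ := by
    rw [← inv_neg]; congr 1; ring
  rw [h]
  simp [mul_comm]

lemma commute_rotor {T X : Op D} (l : ℝ) (hT : Commute T X)
    (hT' : ∀ i j, Commute T (siteUnit hM x i j)) : Commute T (rotor hM x l X) :=
  Commute.sum_right _ _ _ fun _ _ => Commute.sum_right _ _ _ fun _ _ =>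
    (((hT' _ _).mul_right hT).mul_right (hT' _ _)).smul_right _

lemma siteUnit_mul_onSite (i : Fin D) :
    siteUnit hM x i i * onSite x M = (hM.eigenvalues i : ℂ) • siteUnit hM x i i := by
  rw [← sum_eigenvalues_smul_siteUnit hM x]
  simp only [Finset.mul_sum, mul_smul_comm, siteUnit_mul]
  simp

lemma onSite_mul_siteUnit (i : Fin D) :
    onSite x M * siteUnit hM x i i = (hM.eigenvalues i : ℂ) • siteUnit hM x i i := by
  rw [← sum_eigenvalues_smul_siteUnit hM x]
  simp only [Finset.sum_mul, smul_mul_assoc, siteUnit_mul]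
  simp

lemma opComm_rotor {l : ℝ} (hl : l ≠ 0) (hinj : Function.Injective hM.eigenvalues) (X : Op D) :
    Complex.I • opComm (rotor hM x l X) ((l : ℂ) • onSite x M) = -(X - pinch hM x X) := by
  rw [sub_pinch_eq, rotor, opComm]
  simp only [Finset.sum_mul, Finset.mul_sum, ← Finset.sum_sub_distrib, Finset.smul_sum,
    ← Finset.sum_neg_distrib]
  refine Finset.sum_congr rfl fun i _ => Finset.sum_congr rfl fun j _ => ?_
  set c : ℝ := (l * (hM.eigenvalues i - hM.eigenvalues j))⁻¹ with hc
  have h1 : siteUnit hM x i i * X * siteUnit hM x j j * onSite x M =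
      (hM.eigenvalues j : ℂ) • (siteUnit hM x i i * X * siteUnit hM x j j) := by
    rw [mul_assoc _ _ (onSite x M), siteUnit_mul_onSite, mul_smul_comm]
  have h2 : onSite x M * (siteUnit hM x i i * X * siteUnit hM x j j) =
      (hM.eigenvalues i : ℂ) • (siteUnit hM x i i * X * siteUnit hM x j j) := by
    rw [← mul_assoc, ← mul_assoc, onSite_mul_siteUnit, smul_mul_assoc, smul_mul_assoc]
  simp only [smul_mul_assoc, mul_smul_comm, h1, h2, smul_smul, ← sub_smul]
  have h3 : Complex.I * (l * (-Complex.I * c * hM.eigenvalues j) -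
      -Complex.I * c * (l * hM.eigenvalues i)) =
      -((l * (hM.eigenvalues i - hM.eigenvalues j) * c : ℝ) : ℂ) := by
    push_cast
    linear_combination (-(l : ℂ) * c * hM.eigenvalues j + c * l * hM.eigenvalues i) * Complex.I_sq
  split_ifs with hij
  · subst hij
    simp [hc]
  · have h4 : l * (hM.eigenvalues i - hM.eigenvalues j) ≠ 0 :=
      mul_ne_zero hl (sub_ne_zero.2 fun h => hij (hinj h))
    rw [hc, mul_inv_cancel₀ h4, Complex.ofReal_one] at h3
    rw [← neg_one_smul ℂ (siteUnit hM x i i * X * siteUnit hM x j j)]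
    congr 1

lemma spectralGap_le {i j : Fin D} (hij : i ≠ j) :
    spectralGap hM ≤ |hM.eigenvalues i - hM.eigenvalues j| :=
  ciInf_le (f := fun p : {p : Fin D × Fin D // p.1 ≠ p.2} =>
    |hM.eigenvalues p.1.1 - hM.eigenvalues p.1.2|) (Set.finite_range _).bddBelow ⟨(i, j), hij⟩

lemma spectralGap_pos (hD : 2 ≤ D) (hinj : Function.Injective hM.eigenvalues) :
    0 < spectralGap hM := by
  have : Nonempty {p : Fin D × Fin D // p.1 ≠ p.2} :=
    ⟨⟨(⟨0, by omega⟩, ⟨1, by omega⟩), by simp⟩⟩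
  obtain ⟨p, hp⟩ := exists_eq_ciInf_of_finite (f := fun p : {p : Fin D × Fin D // p.1 ≠ p.2} =>
    |hM.eigenvalues p.1.1 - hM.eigenvalues p.1.2|)
  rw [spectralGap, ← hp]
  exact abs_pos.2 (sub_ne_zero.2 fun h => p.2 (hinj h))

lemma norm_rotor_le (hD : 2 ≤ D) {l : ℝ} (hl : l ≠ 0) (hinj : Function.Injective hM.eigenvalues)
    (X : Op D) :
    ‖rotor hM x l X‖ ≤ 2 * (D.choose 2 : ℝ) * (‖X‖ / (|l| * spectralGap hM)) := by
  have hgap := spectralGap_pos hM hD hinj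
  rw [rotor, ← sum_offDiag_const]
  refine (norm_sum_le _ _).trans (Finset.sum_le_sum fun i _ => (norm_sum_le _ _).trans
    (Finset.sum_le_sum fun j _ => ?_))
  split_ifs with h
  · subst h
    simp
  · rw [norm_smul, norm_mul, norm_neg, Complex.norm_I, one_mul, Complex.norm_real,
      Real.norm_eq_abs, abs_inv, abs_mul, div_eq_inv_mul]
    have h1 := spectralGap_le hM h
    have hl' : 0 < |l| := abs_pos.2 hl
    gcongr
    exact norm_siteUnit_mul_mul_le hM x X i j

end Impurity

/-! ### Nearest-neighbour Hamiltonians and their cuts -/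

section Cuts

variable {D : ℕ}

/-- A finite nearest-neighbour Hamiltonian, given by its bond terms on `{z, z + 1}` and its on-site
terms, both of which vanish outside the finite set `sites`. -/
structure Chain (D : ℕ) where
  /-- The term on the bond `{z, z + 1}`. -/
  bond : ℤ → Op D
  /-- The term at the site `z`. -/
  site : ℤ → Op D
  /-- A finite set outside of which all terms vanish. -/
  sites : Finset ℤ
  bond_mem : ∀ z, bond z ∈ siteAlgebra D {z, z + 1}
  site_mem : ∀ z, site z ∈ siteAlgebra D {z}
  bond_sa : ∀ z, IsSelfAdjoint (bond z)
  site_sa : ∀ z, IsSelfAdjoint (site z)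
  bond_eq_zero : ∀ z, z ∉ sites → bond z = 0
  site_eq_zero : ∀ z, z ∉ sites → site z = 0

namespace Chain

variable (c : Chain D)

/-- The Hamiltonian of the chain. -/
noncomputable def ham : Op D := ∑ z ∈ c.sites, (c.bond z + c.site z)

/-- The sum of all terms acting on `(-∞, y]`. -/
noncomputable def left (y : ℤ) : Op D :=
  ∑ z ∈ c.sites, ((if z < y then c.bond z else 0) + if z ≤ y then c.site z else 0)

/-- The sum of all terms acting on `(y, ∞)`. -/
noncomputable def right (y : ℤ) : Op D :=
  ∑ z ∈ c.sites, if y < z then c.bond z + c.site z else 0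

lemma sum_ite_bond (y : ℤ) : ∑ z ∈ c.sites, (if z = y then c.bond z else 0) = c.bond y := by
  rw [Finset.sum_ite_eq']
  split_ifs with h
  · rfl
  · exact (c.bond_eq_zero y h).symm

lemma sum_ite_site (y : ℤ) : ∑ z ∈ c.sites, (if z = y then c.site z else 0) = c.site y := by
  rw [Finset.sum_ite_eq']
  split_ifs with h
  · rfl
  · exact (c.site_eq_zero y h).symm

lemma ham_eq (y : ℤ) : c.ham = c.left y + c.bond y + c.right y := by
  rw [ham, left, right, ← sum_ite_bond, ← Finset.sum_add_distrib, ← Finset.sum_add_distrib]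
  refine Finset.sum_congr rfl fun z _ => ?_
  rcases lt_trichotomy z y with h | h | h
  · simp [h, h.le, h.ne, h.not_gt]
  · simp [h, add_comm]
  · simp [h, h.ne', h.not_gt, h.not_ge]

lemma left_eq (y : ℤ) : c.left y = c.left (y - 1) + c.bond (y - 1) + c.site y := by
  rw [left, left, ← sum_ite_bond, ← sum_ite_site, ← Finset.sum_add_distrib,
    ← Finset.sum_add_distrib]
  refine Finset.sum_congr rfl fun z _ => ?_
  rcases lt_trichotomy z (y - 1) with h | h | h
  · simp [h, h.le, h.ne, show z < y by omega, show z ≤ y by omega, show z ≠ y by omega]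
  · simp [h, add_comm]
  · rcases eq_or_ne z y with h' | h'
    · simp [h', show ¬ y < y - 1 by omega, show y ≠ y - 1 by omega]
    · simp [h', h.ne', h.not_gt, h.not_ge, show ¬ z < y by omega, show ¬ z ≤ y by omega]

lemma right_eq (y : ℤ) : c.right y = c.site (y + 1) + c.bond (y + 1) + c.right (y + 1) := by
  rw [right, right, ← sum_ite_bond, ← sum_ite_site, ← Finset.sum_add_distrib,
    ← Finset.sum_add_distrib]
  refine Finset.sum_congr rfl fun z _ => ?_
  rcases lt_trichotomy z (y + 1) with h | h | h
  · simp [h.ne, h.not_gt, show ¬ y < z by omega]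
  · simp [h, add_comm]
  · simp [h, h.ne', show y < z by omega]

lemma isSelfAdjoint_left (y : ℤ) : IsSelfAdjoint (c.left y) := by
  refine isSelfAdjoint_sum _ fun z _ => ?_
  split_ifs <;> simp [c.bond_sa z, c.site_sa z, IsSelfAdjoint.add]

lemma isSelfAdjoint_right (y : ℤ) : IsSelfAdjoint (c.right y) := by
  refine isSelfAdjoint_sum _ fun z _ => ?_
  split_ifs <;> simp [c.bond_sa z, c.site_sa z, IsSelfAdjoint.add]

lemma isSelfAdjoint_ham : IsSelfAdjoint c.ham :=
  isSelfAdjoint_sum _ fun z _ => (c.bond_sa z).add (c.site_sa z)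

lemma isLeftOf_bond {z y : ℤ} (h : z < y) : IsLeftOf (c.bond z) y :=
  isLeftOf_of_mem (c.bond_mem z) fun w hw => by
    simp only [Finset.mem_insert, Finset.mem_singleton] at hw
    omega

lemma isLeftOf_site {z y : ℤ} (h : z ≤ y) : IsLeftOf (c.site z) y :=
  isLeftOf_of_mem (c.site_mem z) fun w hw => by
    simp only [Finset.mem_singleton] at hw
    omega

lemma isLeftOf_left (y : ℤ) : IsLeftOf (c.left y) y := by
  intro X hX C hC
  refine Commute.sum_left _ _ _ fun z _ => Commute.add_left ?_ ?_
  · split_ifs with h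
    · exact c.isLeftOf_bond h X hX C hC
    · exact Commute.zero_left _
  · split_ifs with h
    · exact c.isLeftOf_site h X hX C hC
    · exact Commute.zero_left _

end Chain

lemma IsLeftOf.commute_bond {c : Chain D} {A : Op D} {y z : ℤ} (hA : IsLeftOf A y) (h : y < z) :
    Commute A (c.bond z) :=
  hA _ (fun w hw => by simp only [Finset.mem_insert, Finset.mem_singleton] at hw; omega) _
    (c.bond_mem z)

lemma IsLeftOf.commute_site {c : Chain D} {A : Op D} {y z : ℤ} (hA : IsLeftOf A y) (h : y < z) :
    Commute A (c.site z) :=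
  hA _ (fun w hw => by simp only [Finset.mem_singleton] at hw; omega) _ (c.site_mem z)

lemma IsLeftOf.commute_right {c : Chain D} {A : Op D} {y : ℤ} (hA : IsLeftOf A y) :
    Commute A (c.right y) :=
  Commute.sum_right _ _ _ fun z _ => by
    split_ifs with h
    · exact (hA.commute_bond h).add_right (hA.commute_site h)
    · exact Commute.zero_right _

lemma IsLeftOf.commute_siteUnit {A : Op D} {y x : ℤ} {M : Matrix (Fin D) (Fin D) ℂ}
    (hM : M.IsHermitian) (hA : IsLeftOf A y) (h : y < x) (i j : Fin D) :
    Commute A (siteUnit hM x i j) :=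
  hA _ (fun w hw => by simp only [Finset.mem_singleton] at hw; omega) _ (siteUnit_mem hM x i j)

lemma commute_siteUnit_of_mem {C : Op D} {X : Finset ℤ} (hC : C ∈ siteAlgebra D X) {x : ℤ}
    (hx : x ∉ X) {M : Matrix (Fin D) (Fin D) ℂ} (hM : M.IsHermitian) (i j : Fin D) :
    Commute C (siteUnit hM x i j) :=
  commute_of_disjoint (by simpa using hx) hC (siteUnit_mem hM x i j)

lemma IsLeftOf.pinch {M : Matrix (Fin D) (Fin D) ℂ} (hM : M.IsHermitian) {x y : ℤ} (h : x ≤ y)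
    {X : Op D} (hX : IsLeftOf X y) : IsLeftOf (pinch hM x X) y := fun Y hY C hC =>
  (commute_pinch hM x (hX Y hY C hC).symm fun i j => commute_siteUnit_of_mem hC
    (fun hx => absurd (hY x hx) (not_lt.2 h)) hM i j).symm

lemma IsLeftOf.rotor {M : Matrix (Fin D) (Fin D) ℂ} (hM : M.IsHermitian) {x y : ℤ} (h : x ≤ y)
    (l : ℝ) {X : Op D} (hX : IsLeftOf X y) : IsLeftOf (rotor hM x l X) y := fun Y hY C hC =>
  (commute_rotor hM x l (hX Y hY C hC).symm fun i j => commute_siteUnit_of_mem hC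
    (fun hx => absurd (hY x hx) (not_lt.2 h)) hM i j).symm

/-- A Hamiltonian that splits into two commuting halves does not transport `A` to `B`. -/
lemma commute_heisenberg_of_decoupled {Hl Hr A B : Op D} (hlr : Commute Hl Hr)
    (hlB : Commute Hl B) (hAr : Commute A Hr) (hAB : Commute A B) (t : ℝ) :
    Commute A (heisenberg (Hl + Hr) t B) := by
  rw [heisenberg_add_hamiltonian hlr, heisenberg_of_commute hlB]
  exact commute_heisenberg hAr hAB t

/-- Observables to the left of `y` reach `B` at time `t` with strength at most `p |t|`. -/
def TransportBound (H B : Op D) (y : ℤ) (p : ℝ → ℝ) : Prop :=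
  ∀ A, IsLeftOf A y → ∀ t : ℝ, ‖opComm (heisenberg H t A) B‖ ≤ ‖A‖ * p |t|

/-- Crossing the bond `{y, y + 1}` costs a time integral and the strength `β` of the bond. -/
lemma TransportBound.bond_step (c : Chain D) {B : Op D} {Y : Finset ℤ} (hB : B ∈ siteAlgebra D Y)
    {y : ℤ} (hY : ∀ z ∈ Y, y < z) {β : ℝ} (hβ : ‖c.bond y‖ ≤ β) {p g g' : ℝ → ℝ}
    (hp : TransportBound c.ham B (y + 1) p) (hp0 : ∀ s, 0 ≤ s → 0 ≤ p s)
    (hg : ∀ s, HasDerivAt g (g' s) s) (hg0 : 0 ≤ g 0) (hpg : ∀ s, 0 ≤ s → β * p s ≤ g' s) :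
    TransportBound c.ham B y fun s => 2 * g s := by
  intro A hA t
  have hAr : Commute A (c.right y) := hA.commute_right
  have hlr : Commute (c.left y) (c.right y) := (c.isLeftOf_left y).commute_right
  have hT : c.ham - (c.left y + c.right y) = c.bond y := by
    rw [c.ham_eq y]; abel
  have h := norm_opComm_heisenberg_le c.isSelfAdjoint_ham
    ((c.isSelfAdjoint_left y).add (c.isSelfAdjoint_right y)) (A := A) (B := B) hg hg0 t
    (commute_heisenberg_of_decoupled hlr (c.isLeftOf_left y Y hY B hB) hAr (hA Y hY B hB) (-t))
    (fun s _ => by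
      rw [hT]
      calc _ ≤ ‖c.bond y‖ * p |s| := hp _ (c.isLeftOf_bond (lt_add_one y)) s
        _ ≤ β * p |s| := by
          gcongr
          exact hp0 _ (abs_nonneg s)
        _ ≤ g' |s| := hpg _ (abs_nonneg s))
  linarith

lemma commute_pinch_onSite {M : Matrix (Fin D) (Fin D) ℂ} (hM : M.IsHermitian) (x : ℤ) (X : Op D) :
    Commute (pinch hM x X) (onSite x M) := by
  rw [pinch_eq_sum_block, ← sum_eigenvalues_smul_siteUnit hM x]
  refine Commute.sum_left _ _ _ fun k _ => Commute.sum_right _ _ _ fun l _ =>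
    Commute.smul_right ?_ _
  refine Commute.mul_left ?_ (commute_block_siteUnit hM x X l l k)
  rw [Commute, SemiconjBy, siteUnit_mul, siteUnit_mul]
  by_cases hkl : k = l
  · subst hkl; rfl
  · rw [if_neg hkl, if_neg (Ne.symm hkl)]

lemma isSelfAdjoint_onSite {M : Matrix (Fin D) (Fin D) ℂ} (hM : M.IsHermitian) (x : ℤ) :
    IsSelfAdjoint (onSite x M) := by
  rw [IsSelfAdjoint, ← onSite_star, Matrix.star_eq_conjTranspose, hM.eq]

/-- Crossing an impurity at `x` costs a factor that is inversely proportional to its strength.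

In the frame rotated by the generator `rotor` the chain is decoupled at `x`, up to a remainder of
the size of the generator, supported at distance at most `2` from `x`.  The two terms of the
factor `1 + 8 β s` stem from the rotation of `A` and from the remainder. -/
lemma TransportBound.impurity_step (hD : 2 ≤ D) (c : Chain D) {M : Matrix (Fin D) (Fin D) ℂ}
    (hM : M.IsHermitian) (hinj : Function.Injective hM.eigenvalues) {l : ℝ} (hl : l ≠ 0) {x : ℤ}
    (hx : c.site x = (l : ℂ) • onSite x M) (hxl : c.site (x - 1) = 0) (hxr : c.site (x + 1) = 0)
    {B : Op D} {Y : Finset ℤ} (hB : B ∈ siteAlgebra D Y) (hY : ∀ z ∈ Y, x + 1 < z)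
    {β : ℝ} (hβ : ∀ z, ‖c.bond z‖ ≤ β) {p : ℝ → ℝ}
    (hp : TransportBound c.ham B (x + 2) p) (hp0 : ∀ s, 0 ≤ s → 0 ≤ p s)
    (hpm : MonotoneOn p (Set.Ici 0)) :
    TransportBound c.ham B (x - 1) fun s =>
      16 * (D.choose 2 : ℝ) ^ 2 * β / (|l| * spectralGap hM) * (1 + 8 * β * s) * p s := by
  have hβ0 : 0 ≤ β := (norm_nonneg _).trans (hβ 0)
  set b : ℝ := (D.choose 2 : ℝ) with hb
  have hb1 : 1 ≤ b := Nat.one_le_cast.2 (Nat.choose_pos hD)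
  have hgap := spectralGap_pos hM hD hinj
  set X : Op D := c.bond (x - 1) + c.bond x with hX
  set N : Op D := c.bond (x - 2) + X + c.bond (x + 1) with hN
  set W : Op D := X - pinch hM x X with hW
  set Q : Op D := rotor hM x l X with hQ
  set v : Op D := c.site x with hv
  set rest : Op D := c.left (x - 2) + c.right (x + 1) with hrest
  set H₀ : Op D := rest + N + v - W with hH₀
  have hXsa : IsSelfAdjoint X := (c.bond_sa _).add (c.bond_sa _)
  have hQsa : IsSelfAdjoint Q := isSelfAdjoint_rotor hM x l hXsa
  -- Locality of the operators involved.
  have hXl : IsLeftOf X (x + 1) := (c.isLeftOf_bond (by omega)).add (c.isLeftOf_bond (by omega))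
  have hNl : IsLeftOf N (x + 2) := ((c.isLeftOf_bond (by omega)).add (hXl.mono (by omega))).add
    (c.isLeftOf_bond (by omega))
  have hWl : IsLeftOf W (x + 1) := hXl.sub (hXl.pinch hM (by omega))
  have hQl : IsLeftOf Q (x + 1) := hXl.rotor hM (by omega) l
  have hvl : IsLeftOf v (x + 1) := c.isLeftOf_site (by omega)
  -- Two decompositions of the Hamiltonian.
  have hleft : c.left (x - 1) = c.left (x - 2) + c.bond (x - 2) := by
    rw [c.left_eq (x - 1), hxl, add_zero, show x - 1 - 1 = x - 2 by ring]
  have hright : c.right x = c.bond (x + 1) + c.right (x + 1) := by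
    rw [c.right_eq x, hxr, zero_add]
  have hham : c.ham = rest + N + v := by
    rw [c.ham_eq (x - 1), c.right_eq (x - 1), show x - 1 + 1 = x by ring, hleft, hright]
    simp only [hrest, hN, hX, hv]
    abel
  have hsplit : H₀ = (c.left (x - 1) + pinch hM x (c.bond (x - 1))) +
      (v + pinch hM x (c.bond x) + c.right x) := by
    simp only [hH₀, hW, hN, hrest, hleft, hright]
    rw [hX, pinch_add]
    abel
  have hH₀sa : IsSelfAdjoint H₀ := by
    rw [hsplit]
    exact ((c.isSelfAdjoint_left _).add (isSelfAdjoint_pinch hM x (c.bond_sa _))).add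
      (((c.site_sa _).add (isSelfAdjoint_pinch hM x (c.bond_sa _))).add (c.isSelfAdjoint_right _))
  -- `H₀` is decoupled at `x`.
  have hpl : IsLeftOf (pinch hM x (c.bond (x - 1))) x :=
    (c.isLeftOf_bond (by omega)).pinch hM le_rfl
  have hll := c.isLeftOf_left (x - 1)
  have hlr : Commute (c.left (x - 1) + pinch hM x (c.bond (x - 1)))
      (v + pinch hM x (c.bond x) + c.right x) := by
    refine Commute.add_left (Commute.add_right (Commute.add_right ?_ ?_) ?_)
      (Commute.add_right (Commute.add_right ?_ ?_) ?_)
    · exact hll.commute_site (by omega)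
    · exact commute_pinch hM x (hll.commute_bond (by omega))
        (hll.commute_siteUnit hM (by omega))
    · exact (hll.mono (by omega)).commute_right
    · rw [hx]
      exact (commute_pinch_onSite hM x _).smul_right _
    · refine commute_pinch_pinch hM x (X := {x - 1}) (Y := {x + 1}) (by simp) ?_ ?_ ?_
      · rw [Finset.disjoint_singleton]; omega
      · have := c.bond_mem (x - 1)
        rwa [show x - 1 + 1 = x by ring, Finset.insert_eq] at this
      · exact c.bond_mem x
    · exact hpl.commute_right
  -- The rotated Hamiltonian and its distance from `H₀`.
  have hrestQ : Commute Q rest := by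
    refine Commute.add_right ?_ hQl.commute_right
    have h2 := c.isLeftOf_left (x - 2)
    exact (commute_rotor hM x l
      ((h2.commute_bond (by omega)).add_right (h2.commute_bond (by omega)))
      (h2.commute_siteUnit hM (by omega))).symm
  set H' : Op D := heisenberg Q 1 c.ham with hH'
  have hH'sa : IsSelfAdjoint H' := isSelfAdjoint_heisenberg hQsa c.isSelfAdjoint_ham 1
  have hR : H' - H₀ = (heisenberg Q 1 N - N) + (heisenberg Q 1 v - v + W) := by
    rw [hH', hham, heisenberg_add, heisenberg_add, heisenberg_of_commute hrestQ, hH₀]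
    abel
  have hXn : ‖X‖ ≤ 2 * β := (norm_add_le _ _).trans (by linarith [hβ (x - 1), hβ x])
  have hNn : ‖N‖ ≤ 4 * β := by
    have h1 := norm_add_le (c.bond (x - 2) + X) (c.bond (x + 1))
    have h2 := norm_add_le (c.bond (x - 2)) X
    linarith [hβ (x - 2), hβ (x + 1)]
  have hWn : ‖W‖ ≤ 4 * b * β := by
    calc ‖W‖ ≤ 2 * b * ‖X‖ := norm_sub_pinch_le hM x X
      _ ≤ 2 * b * (2 * β) := by gcongr
      _ = _ := by ring
  have hRn : ‖H' - H₀‖ ≤ 16 * b * β * ‖Q‖ := by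
    have hQv : Complex.I • opComm Q v = -W := by
      rw [hx]
      exact opComm_rotor hM x hl hinj X
    calc ‖H' - H₀‖ ≤ ‖opComm Q N‖ + ‖opComm Q W‖ := by
          rw [hR]
          exact (norm_add_le _ _).trans (add_le_add (norm_heisenberg_one_sub_le hQsa N)
            (norm_heisenberg_sub_add_le hQsa hQv))
      _ ≤ 2 * ‖Q‖ * ‖N‖ + 2 * ‖Q‖ * ‖W‖ := add_le_add (norm_opComm_le _ _) (norm_opComm_le _ _)
      _ ≤ 2 * ‖Q‖ * (4 * β) + 2 * ‖Q‖ * (4 * b * β) := by gcongr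
      _ = (8 + 8 * b) * β * ‖Q‖ := by ring
      _ ≤ 16 * b * β * ‖Q‖ := by
          gcongr
          linarith
  have hRl : IsLeftOf (H' - H₀) (x + 2) := by
    have hQl2 := hQl.mono (show x + 1 ≤ x + 2 by omega)
    have hvl2 := hvl.mono (show x + 1 ≤ x + 2 by omega)
    rw [hR]
    exact ((hQl2.heisenberg hNl 1).sub hNl).add
      (((hQl2.heisenberg hvl2 1).sub hvl2).add (hWl.mono (by omega)))
  -- Operators in the rotated frame are seen from the original frame.
  have hQB : heisenberg Q 1 B = B := heisenberg_of_commute (hQl Y hY B hB) 1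
  have hframe : ∀ (T : Op D) (s : ℝ), IsLeftOf T (x + 2) →
      ‖opComm (heisenberg H' s T) B‖ ≤ ‖T‖ * p |s| := by
    intro T s hT
    have h1 : IsLeftOf (heisenberg Q (-1) T) (x + 2) := (hQl.mono (by omega)).heisenberg hT (-1)
    have h2 := hp _ h1 s
    rw [norm_heisenberg hQsa, ← norm_heisenberg hQsa 1 (opComm _ B), heisenberg_opComm,
      heisenberg_conj, heisenberg_heisenberg_neg, hQB] at h2
    exact h2
  intro A hA t
  set P : ℝ := p |t| with hP
  have hP0 : 0 ≤ P := hp0 _ (abs_nonneg t)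
  have h1 : ‖opComm (heisenberg H' t A) B‖ ≤ 2 * ‖A‖ * (‖H' - H₀‖ * P * |t|) := by
    refine norm_opComm_heisenberg_le hH'sa hH₀sa (g := fun s => ‖H' - H₀‖ * P * s)
      (g' := fun _ => ‖H' - H₀‖ * P) (fun s => by
        simpa using (hasDerivAt_id s).const_mul (‖H' - H₀‖ * P)) (by simp) t ?_ fun s hs => ?_
    · rw [hsplit]
      refine commute_heisenberg_of_decoupled hlr ?_ ?_ ?_ (-t)
      · exact ((hll.mono (by omega)).add hpl) Y (fun z hz => by have := hY z hz; omega) B hB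
      · exact ((hA.commute_site (by omega)).add_right (commute_pinch hM x
          (hA.commute_bond (by omega)) (hA.commute_siteUnit hM (by omega)))).add_right
          (hA.mono (by omega)).commute_right
      · exact hA Y (fun z hz => by have := hY z hz; omega) B hB
    · refine (hframe _ s hRl).trans ?_
      gcongr
      exact hpm (abs_nonneg s) (abs_nonneg t) hs
  have h2 : ‖opComm (heisenberg H' t (heisenberg Q 1 A - A)) B‖ ≤ 2 * ‖Q‖ * ‖A‖ * P := by
    have hA2 := hA.mono (show x - 1 ≤ x + 2 by omega)
    refine (hframe _ t (((hQl.mono (by omega)).heisenberg hA2 1).sub hA2)).trans ?_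
    gcongr
    exact (norm_heisenberg_one_sub_le hQsa A).trans (norm_opComm_le _ _)
  have h3 : ‖opComm (heisenberg c.ham t A) B‖ ≤
      ‖opComm (heisenberg H' t A) B‖ + ‖opComm (heisenberg H' t (heisenberg Q 1 A - A)) B‖ := by
    rw [← norm_heisenberg hQsa 1 (opComm _ B), heisenberg_opComm, heisenberg_conj, hQB]
    refine le_trans (le_of_eq ?_) (norm_add_le _ _)
    rw [← opComm_add_left, ← heisenberg_add, add_sub_cancel]
  have hQn : ‖Q‖ ≤ 4 * b * β / (|l| * spectralGap hM) := by
    calc ‖Q‖ ≤ 2 * b * (‖X‖ / (|l| * spectralGap hM)) := norm_rotor_le hM x hD hl hinj X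
      _ ≤ 2 * b * (2 * β / (|l| * spectralGap hM)) := by gcongr
      _ = _ := by ring
  calc ‖opComm (heisenberg c.ham t A) B‖
      ≤ 2 * ‖A‖ * (‖H' - H₀‖ * P * |t|) + 2 * ‖Q‖ * ‖A‖ * P := by linarith
    _ ≤ 2 * ‖A‖ * ((16 * b * β * ‖Q‖) * P * |t|) + 2 * ‖Q‖ * ‖A‖ * P := by gcongr
    _ = ‖A‖ * (2 * ‖Q‖ * (1 + 16 * b * β * |t|) * P) := by ring
    _ ≤ ‖A‖ * (2 * (4 * b * β / (|l| * spectralGap hM)) * (2 * b * (1 + 8 * β * |t|)) * P) := by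
        gcongr
        nlinarith [mul_nonneg hβ0 (abs_nonneg t)]
    _ = _ := by simp only [hP]; ring

end Cuts

/-! ### Propagation through several impurities -/

section Propagation

variable {D : ℕ}

/-- The time profile `K (1 + 8 β s)ⁿ (2 β s)ᵐ / m!` that results from crossing `n` impurities and
`m` bonds. -/
noncomputable def profile (β K : ℝ) (n m : ℕ) (s : ℝ) : ℝ :=
  K * (1 + 8 * β * s) ^ n * ((2 * β * s) ^ m / (m.factorial : ℝ))

lemma profile_nonneg {β K : ℝ} (hβ : 0 ≤ β) (hK : 0 ≤ K) (n m : ℕ) {s : ℝ} (hs : 0 ≤ s) :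
    0 ≤ profile β K n m s := by
  unfold profile
  positivity

lemma monotoneOn_profile {β K : ℝ} (hβ : 0 ≤ β) (hK : 0 ≤ K) (n m : ℕ) :
    MonotoneOn (profile β K n m) (Set.Ici 0) := by
  intro s hs t _ hst
  have hs' : (0 : ℝ) ≤ s := hs
  have ht' : (0 : ℝ) ≤ t := hs'.trans hst
  unfold profile
  gcongr

lemma profile_mul (β a e q : ℝ) (n m : ℕ) (s : ℝ) :
    profile β (a * (e * q)) (n + 1) m s = e * (1 + 8 * β * s) * profile β (a * q) n m s := by
  rw [profile, profile, pow_succ]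
  ring

lemma hasDerivAt_profile (β K : ℝ) (n m : ℕ) (s : ℝ) :
    HasDerivAt (profile β K n m)
      (K * (n * (1 + 8 * β * s) ^ (n - 1) * (8 * β)) * ((2 * β * s) ^ m / (m.factorial : ℝ)) +
        K * (1 + 8 * β * s) ^ n * (m * (2 * β * s) ^ (m - 1) * (2 * β) / (m.factorial : ℝ))) s := by
  have h1 : HasDerivAt (fun s : ℝ => 1 + 8 * β * s) (8 * β) s := by
    simpa using ((hasDerivAt_id s).const_mul (8 * β)).const_add 1
  have h2 : HasDerivAt (fun s : ℝ => 2 * β * s) (2 * β) s := by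
    simpa using (hasDerivAt_id s).const_mul (2 * β)
  exact ((h1.pow n).const_mul K).mul ((h2.pow m).div_const _)

/-- Crossing one more bond raises the number of bonds in the profile by one. -/
lemma mul_profile_le_deriv {β K : ℝ} (hβ : 0 ≤ β) (hK : 0 ≤ K) (n m : ℕ) {s : ℝ} (hs : 0 ≤ s) :
    2 * β * profile β K n m s ≤
      K * (n * (1 + 8 * β * s) ^ (n - 1) * (8 * β)) *
        ((2 * β * s) ^ (m + 1) / ((m + 1).factorial : ℝ)) +
      K * (1 + 8 * β * s) ^ n *
        ((m + 1 : ℕ) * (2 * β * s) ^ (m + 1 - 1) * (2 * β) / ((m + 1).factorial : ℝ)) := by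
  have h : K * (1 + 8 * β * s) ^ n *
        ((m + 1 : ℕ) * (2 * β * s) ^ (m + 1 - 1) * (2 * β) / ((m + 1).factorial : ℝ)) =
      2 * β * profile β K n m s := by
    have : (m.factorial : ℝ) ≠ 0 := by positivity
    have : ((m : ℝ) + 1) ≠ 0 := by positivity
    rw [profile, Nat.factorial_succ, Nat.add_sub_cancel]
    push_cast
    field_simp
  rw [h]
  have : 0 ≤ K * (n * (1 + 8 * β * s) ^ (n - 1) * (8 * β)) *
        ((2 * β * s) ^ (m + 1) / ((m + 1).factorial : ℝ)) := by positivity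
  linarith

/-- Transport from the half-line `(-∞, y]` to an observable `B` on `[b, ∞)`.  Each impurity in
between uses up three of the `b - y` bonds, and each of the `m` remaining bonds costs a time
integral.  An impurity outside of the chain is accounted for by the missing bond to its left. -/
theorem Chain.exists_transportBound (hD : 2 ≤ D) (c : Chain D)
    {V : ℤ → Matrix (Fin D) (Fin D) ℂ} (hV : ∀ x, (V x).IsHermitian) {l : ℤ → ℝ}
    {β : ℝ} (hβ : ∀ z, ‖c.bond z‖ ≤ β) {B : Op D} {Y : Finset ℤ} (hB : B ∈ siteAlgebra D Y)
    {b : ℤ} (hY : ∀ z ∈ Y, b ≤ z) (k : ℕ) :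
    ∀ (y : ℤ) (Z : Finset ℤ), b - y = k →
      (∀ x ∈ Z, l x ≠ 0 ∧ Function.Injective (hV x).eigenvalues ∧ (c.bond (x - 1) = 0 ∨
        c.site x = (l x : ℂ) • onSite x (V x) ∧ c.site (x - 1) = 0 ∧ c.site (x + 1) = 0)) →
      (∀ x ∈ Z, ∀ x' ∈ Z, x < x' → x + 3 ≤ x') → (∀ x ∈ Z, y < x ∧ x + 3 ≤ b) →
      ∃ m : ℕ, (m : ℤ) + 3 * Z.card = b - y ∧ (y < b → 1 ≤ m) ∧
        TransportBound c.ham B y (profile β (2 * ‖B‖ * ∏ x ∈ Z,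
          (16 * (D.choose 2 : ℝ) ^ 2 * β / (|l x| * spectralGap (hV x)))) Z.card m) := by
  have hβ0 : 0 ≤ β := (norm_nonneg _).trans (hβ 0)
  have hK : ∀ Z : Finset ℤ, (∀ x ∈ Z, Function.Injective (hV x).eigenvalues) →
      0 ≤ 2 * ‖B‖ * ∏ x ∈ Z,
        (16 * (D.choose 2 : ℝ) ^ 2 * β / (|l x| * spectralGap (hV x))) := fun Z hZ => by
    refine mul_nonneg (by positivity) (Finset.prod_nonneg fun x hx => ?_)
    have := spectralGap_pos (hV x) hD (hZ x hx)
    positivity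
  induction k using Nat.strong_induction_on with
  | _ k ih =>
    intro y Z hk hZ hsp hZb
    rcases Nat.eq_zero_or_pos k with rfl | hkpos
    · -- All of the way has been covered.
      have hZe : Z = ∅ := Finset.eq_empty_of_forall_notMem fun x hx => by
        have := hZb x hx
        push_cast at hk
        omega
      subst hZe
      refine ⟨0, by simpa using hk.symm, fun h => by push_cast at hk; omega, fun A _ t => ?_⟩
      refine (norm_opComm_le _ _).trans (le_of_eq ?_)
      rw [norm_heisenberg c.isSelfAdjoint_ham]
      simp [profile]
      ring
    · by_cases hy : y + 1 ∈ Z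
      · -- The next site carries an impurity.
        obtain ⟨hl, hinj, hcase⟩ := hZ _ hy
        have hyb := (hZb _ hy).2
        obtain ⟨m, hm, hm1, hT⟩ := ih (k - 3) (by omega) (y + 3) (Z.erase (y + 1)) (by omega)
          (fun x hx => hZ x (Finset.mem_of_mem_erase hx))
          (fun x hx x' hx' => hsp x (Finset.mem_of_mem_erase hx) x' (Finset.mem_of_mem_erase hx'))
          (fun x hx => by
            have h1 := hZb x (Finset.mem_of_mem_erase hx)
            have h2 := hsp _ hy x (Finset.mem_of_mem_erase hx)
              (lt_of_le_of_ne (by omega) (Finset.ne_of_mem_erase hx).symm)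
            exact ⟨by omega, h1.2⟩)
        have hcard := Finset.card_erase_add_one hy
        refine ⟨m, by rw [← hcard]; push_cast; linarith, fun _ => hm1 (by omega), ?_⟩
        have hK' := hK (Z.erase (y + 1)) fun x hx => (hZ x (Finset.mem_of_mem_erase hx)).2.1
        have hgap := spectralGap_pos (hV (y + 1)) hD hinj
        set K' := 2 * ‖B‖ * ∏ x ∈ Z.erase (y + 1),
          (16 * (D.choose 2 : ℝ) ^ 2 * β / (|l x| * spectralGap (hV x)))
        have hprof : ∀ s, profile β (2 * ‖B‖ * ∏ x ∈ Z,
            (16 * (D.choose 2 : ℝ) ^ 2 * β / (|l x| * spectralGap (hV x)))) Z.card m s =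
            16 * (D.choose 2 : ℝ) ^ 2 * β / (|l (y + 1)| * spectralGap (hV (y + 1))) *
              (1 + 8 * β * s) * profile β K' (Z.erase (y + 1)).card m s := by
          intro s
          rw [← Finset.mul_prod_erase Z _ hy, ← hcard, profile_mul]
        intro A hA t
        rw [hprof]
        have hs := abs_nonneg t
        rcases hcase with h0 | ⟨hx, hxl, hxr⟩
        · rw [show y + 1 - 1 = y by ring] at h0
          have hstep := TransportBound.bond_step c hB (y := y) (fun z hz => by
            have := hY z hz; omega) (β := 0) (by rw [h0, norm_zero]) (g := fun _ => 0)
            (g' := fun _ => 0) (p := fun _ => 2 * ‖B‖) (fun A _ t => by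
              refine (norm_opComm_le _ _).trans (le_of_eq ?_)
              rw [norm_heisenberg c.isSelfAdjoint_ham]
              ring) (fun _ _ => by positivity) (fun s => hasDerivAt_const s 0) le_rfl (by simp)
          refine (hstep A hA t).trans ?_
          have := profile_nonneg hβ0 hK' (Z.erase (y + 1)).card m hs
          simp only [mul_zero]
          positivity
        · refine TransportBound.impurity_step hD c (hV (y + 1)) hinj hl hx hxl hxr hB
            (fun z hz => by have := hY z hz; omega) hβ
            (p := profile β K' (Z.erase (y + 1)).card m) ?_
            (fun s hs => profile_nonneg hβ0 hK' _ _ hs) (monotoneOn_profile hβ0 hK' _ _) A ?_ t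
          · rwa [show y + 1 + 2 = y + 3 by ring]
          · rwa [show y + 1 - 1 = y by ring]
      · -- The next site is an ordinary one.
        obtain ⟨m, hm, -, hT⟩ := ih (k - 1) (by omega) (y + 1) Z (by omega) hZ hsp (fun x hx => by
          have h1 := hZb x hx
          have h2 : x ≠ y + 1 := fun h => hy (h ▸ hx)
          omega)
        refine ⟨m + 1, by push_cast; linarith, fun _ => by omega, ?_⟩
        have hK' := hK Z fun x hx => (hZ x hx).2.1
        set K' := 2 * ‖B‖ * ∏ x ∈ Z,
          (16 * (D.choose 2 : ℝ) ^ 2 * β / (|l x| * spectralGap (hV x)))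
        have hstep := TransportBound.bond_step c hB (y := y) (fun z hz => by
            have := hY z hz; omega) (hβ y) hT (fun s hs => profile_nonneg hβ0 hK' _ _ hs)
            (g := fun s => profile β K' Z.card (m + 1) s / 2)
            (fun s => (hasDerivAt_profile β K' Z.card (m + 1) s).div_const 2)
            (by have := profile_nonneg hβ0 hK' Z.card (m + 1) le_rfl; positivity)
            (fun s hs => by
              have := mul_profile_le_deriv hβ0 hK' Z.card m hs
              linarith)
        intro A hA t
        refine (hstep A hA t).trans (le_of_eq ?_)
        simp only
        ring

end Propagation

/-! ### The constants -/

section Constants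

lemma summable_inv_sq_int : Summable fun z : ℤ => 1 / (1 + |(z : ℝ)|) ^ 2 := by
  have h : Summable fun n : ℕ => 1 / ((n : ℝ) + 1) ^ 2 := by
    simpa using (summable_nat_add_iff 1).2 hasSum_zeta_two.summable
  refine Summable.of_nat_of_neg_add_one (by simpa [add_comm] using h) ?_
  refine Summable.of_nonneg_of_le (fun n => by positivity) (fun n => ?_) h
  rw [abs_of_nonpos (by push_cast; linarith [(Nat.cast_nonneg n : (0 : ℝ) ≤ n)])]
  push_cast
  gcongr 1 / ?_ ^ 2
  linarith

lemma tsum_inv_sq_int_le : ∑' z : ℤ, 1 / (1 + |(z : ℝ)|) ^ 2 ≤ 6 := by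
  have h0 : Summable fun n : ℕ => 1 / ((n : ℝ) + 1) ^ 2 := by
    simpa using (summable_nat_add_iff 1).2 hasSum_zeta_two.summable
  have h1 : ∑' n : ℕ, 1 / ((n : ℝ) + 1) ^ 2 ≤ 3 := by
    have h2 := hasSum_zeta_two.summable.tsum_eq_zero_add
    rw [hasSum_zeta_two.tsum_eq] at h2
    simp only [Nat.cast_zero, Nat.cast_add, Nat.cast_one] at h2
    have h3 : Real.pi ^ 2 / 6 ≤ 3 := by nlinarith [Real.pi_pos, Real.pi_le_four]
    rw [h2] at h3
    simpa using h3
  have hneg : ∀ n : ℕ, 1 / (1 + |((-((n : ℤ) + 1) : ℤ) : ℝ)|) ^ 2 ≤ 1 / ((n : ℝ) + 1) ^ 2 := by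
    intro n
    rw [abs_of_nonpos (by push_cast; linarith [(Nat.cast_nonneg n : (0 : ℝ) ≤ n)])]
    push_cast
    gcongr 1 / ?_ ^ 2
    linarith
  have hs : Summable fun n : ℕ => 1 / (1 + |((-((n : ℤ) + 1) : ℤ) : ℝ)|) ^ 2 :=
    Summable.of_nonneg_of_le (fun n => by positivity) hneg h0
  have hpos : ∀ n : ℕ, 1 / (1 + |(((n : ℤ)) : ℝ)|) ^ 2 = 1 / ((n : ℝ) + 1) ^ 2 := fun n => by
    simp [add_comm]
  have h5 := tsum_of_nat_of_neg_add_one (f := fun z : ℤ => 1 / (1 + |(z : ℝ)|) ^ 2)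
    (by simpa only [hpos] using h0) hs
  simp only [hpos] at h5
  rw [h5]
  have h4 := hs.tsum_le_tsum hneg h0
  linarith

/-- The summand in the definition of `kConst`. -/
noncomputable def kTerm (μ : ℝ) (x y z : ℤ) : ℝ :=
  Real.exp (-μ * (|(x : ℝ) - z| + |(y : ℝ) - z| - |(x : ℝ) - y|)) * (1 + |(x : ℝ) - y|) ^ 2 /
    ((1 + |(x : ℝ) - z|) ^ 2 * (1 + |(z : ℝ) - y|) ^ 2)

lemma kTerm_nonneg (μ : ℝ) (x y z : ℤ) : 0 ≤ kTerm μ x y z := by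
  unfold kTerm
  positivity

lemma kTerm_le {μ : ℝ} (hμ : 0 < μ) (x y z : ℤ) :
    kTerm μ x y z ≤ 2 * (1 / (1 + |((z - x : ℤ) : ℝ)|) ^ 2) +
      2 * (1 / (1 + |((z - y : ℤ) : ℝ)|) ^ 2) := by
  push_cast
  rw [abs_sub_comm (z : ℝ) x, kTerm, abs_sub_comm (y : ℝ) z]
  have htri : |(x : ℝ) - y| ≤ |(x : ℝ) - z| + |(z : ℝ) - y| := abs_sub_le _ _ _
  set a := |(x : ℝ) - z|
  set b := |(z : ℝ) - y|
  set d := |(x : ℝ) - y|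
  have ha : 0 ≤ a := abs_nonneg _
  have hb : 0 ≤ b := abs_nonneg _
  have hd : 0 ≤ d := abs_nonneg _
  have he : Real.exp (-μ * (a + b - d)) ≤ 1 := Real.exp_le_one_iff.2 (by nlinarith)
  have hsq : (1 + d) ^ 2 ≤ 2 * (1 + b) ^ 2 + 2 * (1 + a) ^ 2 := by
    nlinarith [sq_nonneg (a - b)]
  calc _ ≤ 1 * (2 * (1 + b) ^ 2 + 2 * (1 + a) ^ 2) / ((1 + a) ^ 2 * (1 + b) ^ 2) := by gcongr
    _ = _ := by field_simp

lemma summable_shift (x : ℤ) : Summable fun z : ℤ => 1 / (1 + |((z - x : ℤ) : ℝ)|) ^ 2 := by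
  have h := (Equiv.subRight x).summable_iff.2 summable_inv_sq_int
  simpa only [Function.comp_def, Equiv.subRight_apply] using h

lemma tsum_shift (x : ℤ) : ∑' z : ℤ, 1 / (1 + |((z - x : ℤ) : ℝ)|) ^ 2 =
    ∑' z : ℤ, 1 / (1 + |(z : ℝ)|) ^ 2 := by
  have h := (Equiv.subRight x).tsum_eq fun z : ℤ => 1 / (1 + |(z : ℝ)|) ^ 2
  simpa only [Equiv.subRight_apply] using h

lemma summable_kTerm {μ : ℝ} (hμ : 0 < μ) (x y : ℤ) : Summable (kTerm μ x y) :=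
  Summable.of_nonneg_of_le (kTerm_nonneg μ x y) (kTerm_le hμ x y)
    (((summable_shift x).mul_left 2).add ((summable_shift y).mul_left 2))

lemma tsum_kTerm_le {μ : ℝ} (hμ : 0 < μ) (x y : ℤ) : ∑' z, kTerm μ x y z ≤ 24 := by
  have hx := (summable_shift x).mul_left 2
  have hy := (summable_shift y).mul_left 2
  refine ((summable_kTerm hμ x y).tsum_le_tsum (kTerm_le hμ x y) (hx.add hy)).trans ?_
  rw [hx.tsum_add hy, tsum_mul_left, tsum_mul_left, tsum_shift, tsum_shift]
  linarith [tsum_inv_sq_int_le]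

lemma kConst_eq (μ : ℝ) : kConst μ = ⨆ p : ℤ × ℤ, ∑' z, kTerm μ p.1 p.2 z := rfl

lemma kConst_le {μ : ℝ} (hμ : 0 < μ) : kConst μ ≤ 24 := by
  rw [kConst_eq]
  exact ciSup_le fun p => tsum_kTerm_le hμ p.1 p.2

lemma one_le_kConst {μ : ℝ} (hμ : 0 < μ) : 1 ≤ kConst μ := by
  have hb : BddAbove (Set.range fun p : ℤ × ℤ => ∑' z, kTerm μ p.1 p.2 z) :=
    ⟨24, by rintro _ ⟨p, rfl⟩; exact tsum_kTerm_le hμ p.1 p.2⟩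
  rw [kConst_eq]
  refine le_trans ?_ (le_ciSup hb (0, 0))
  refine le_trans (le_of_eq ?_) ((summable_kTerm hμ 0 0).le_tsum 0 fun z _ => kTerm_nonneg μ 0 0 z)
  simp [kTerm]

lemma one_le_cConst {μ : ℝ} (hμ : 0 < μ) : 1 ≤ cConst μ := by
  have hs : Summable fun x : ℤ => Real.exp (-μ * |(x : ℝ)|) / (1 + |(x : ℝ)|) ^ 2 := by
    refine Summable.of_nonneg_of_le (fun _ => by positivity) (fun x => ?_) summable_inv_sq_int
    gcongr
    exact Real.exp_le_one_iff.2 (by nlinarith [abs_nonneg (x : ℝ)])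
  refine le_trans (le_of_eq ?_) (hs.le_tsum 0 fun z _ => by positivity)
  simp

lemma C₀_ge {μ : ℝ} (hμ : 0 < μ) : 10 / 24 ≤ C₀ μ := by
  have h1 := one_le_cConst hμ
  have h2 := one_le_kConst hμ
  have h3 := kConst_le hμ
  rw [C₀]
  gcongr
  linarith

lemma mainConst_pos {D : ℕ} (hD : 2 ≤ D) {μ β : ℝ} (hμ : 0 < μ) (hβ : 0 < β) :
    0 < mainConst μ β D := by
  have h1 : 0 < C₀ μ := lt_of_lt_of_le (by norm_num) (C₀_ge hμ)
  have h2 : 0 < 1 - Real.exp (-μ) := sub_pos.2 (Real.exp_lt_one_iff.2 (by linarith))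
  have h3 : 0 < (D.choose 2 : ℝ) := Nat.cast_pos.2 (Nat.choose_pos hD)
  unfold mainConst
  positivity

/-- The factor `e^{5μ}` of the constant leaves room for the three bonds lost at each impurity. -/
lemma le_mainConst_mul (D : ℕ) {μ β d : ℝ} (hμ : 0 < μ) (hβ : 0 ≤ β) (hd : 1 ≤ d) :
    16 * (D.choose 2 : ℝ) ^ 2 * β ≤ mainConst μ β D * (μ * d) * Real.exp (-(3 * μ)) := by
  generalize hb : (D.choose 2 : ℝ) = b
  have h1 : 16 ≤ 444 * C₀ μ ^ 2 := by nlinarith [C₀_ge hμ]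
  have h2 : 0 < 1 - Real.exp (-μ) := sub_pos.2 (Real.exp_lt_one_iff.2 (by linarith))
  have h3 : 1 ≤ (1 - Real.exp (-μ))⁻¹ :=
    (one_le_inv₀ h2).2 (by linarith [Real.exp_pos (-μ)])
  have h4 : 1 ≤ Real.exp (5 * μ) * Real.exp (-(3 * μ)) := by
    rw [← Real.exp_add]
    exact Real.one_le_exp (by linarith)
  have heq : mainConst μ β D * (μ * d) * Real.exp (-(3 * μ)) =
      (444 * C₀ μ ^ 2) * b ^ 2 * β * (Real.exp (5 * μ) * Real.exp (-(3 * μ))) *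
        (1 - Real.exp (-μ))⁻¹ * d := by
    rw [mainConst, hb]
    field_simp
  rw [heq]
  calc 16 * b ^ 2 * β = 16 * b ^ 2 * β * 1 * 1 * 1 := by ring
    _ ≤ _ := by gcongr

lemma one_add_mul_pow_div_factorial_le {y : ℝ} (hy : 0 ≤ y) {m : ℕ} (hm : 1 ≤ m) :
    2 * (1 + y) * ((y / 4) ^ m / (m.factorial : ℝ)) ≤ y * Real.exp y := by
  obtain ⟨k, rfl⟩ : ∃ k, m = k + 1 := ⟨m - 1, by omega⟩
  have h1 := Real.pow_div_factorial_le_exp y hy k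
  have h2 := Real.pow_div_factorial_le_exp y hy (k + 1)
  have h3 : y ^ k / ((k + 1).factorial : ℝ) ≤ y ^ k / (k.factorial : ℝ) := by
    gcongr
    omega
  have h4 : (1 / 4 : ℝ) ^ (k + 1) ≤ 1 / 4 := by
    rw [pow_succ]
    exact mul_le_of_le_one_left (by norm_num) (pow_le_one₀ (by norm_num) (by norm_num))
  calc 2 * (1 + y) * ((y / 4) ^ (k + 1) / ((k + 1).factorial : ℝ))
      = 2 * (1 / 4) ^ (k + 1) * (y * (y ^ k / ((k + 1).factorial : ℝ) +
          y ^ (k + 1) / ((k + 1).factorial : ℝ))) := by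
        rw [div_eq_mul_one_div y 4, mul_pow]
        ring
    _ ≤ 2 * (1 / 4) * (y * (Real.exp y + Real.exp y)) := by
        gcongr
        exact h3.trans h1
    _ = y * Real.exp y := by ring

/-- The profile of a passage through `n` impurities and `m` bonds, over the distance `m + 3 n`, is
dominated by the bound with exponential decay in the distance. -/
lemma profile_le_boundFactor {D : ℕ} {μ β : ℝ} (hμ : 0 < μ) (hβ : 0 ≤ β) {lam Γ : ℤ → ℝ}
    {Z : Finset ℤ} (hZ : ∀ x ∈ Z, 0 < |lam x| * Γ x) {m : ℕ} (hm : 1 ≤ m) {d : ℝ}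
    (hd : d = m + 3 * Z.card) (t K : ℝ) (hK : 0 ≤ K) :
    profile β (2 * K * ∏ x ∈ Z, (16 * (D.choose 2 : ℝ) ^ 2 * β / (|lam x| * Γ x))) Z.card m |t| ≤
      boundFactor D μ β lam Γ Z t d * K := by
  set N := Z.card with hN
  set s := |t| with hs
  have hs0 : 0 ≤ s := abs_nonneg t
  set y := velocity μ β * s with hy
  have hk := one_le_kConst hμ
  have hβs : 0 ≤ β * s := mul_nonneg hβ hs0
  have hy1 : 2 * β * s * Real.exp μ ≤ y / 4 := by
    rw [hy, velocity]
    nlinarith [mul_nonneg hβs (Real.exp_pos μ).le,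
      mul_nonneg (mul_nonneg hβs (Real.exp_pos μ).le) (sub_nonneg.2 hk)]
  have hy2 : 8 * β * s ≤ y := by
    nlinarith [mul_nonneg hβs (sub_nonneg.2 (Real.one_le_exp hμ.le))]
  have hy0 : 0 ≤ y := le_trans (by positivity) hy2
  have hP : 0 < ∏ x ∈ Z, |lam x| * Γ x := Finset.prod_pos hZ
  have hd1 : 1 ≤ d := by
    have : (1 : ℝ) ≤ m := by exact_mod_cast hm
    have : (0 : ℝ) ≤ (N : ℝ) := Nat.cast_nonneg N
    rw [hd]
    linarith
  set E := 16 * (D.choose 2 : ℝ) ^ 2 * β with hE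
  have hE0 : 0 ≤ E := by positivity
  have hEN : E ^ N ≤ (mainConst μ β D) ^ N * (μ * d) ^ N * Real.exp (-(3 * μ * N)) := by
    calc E ^ N ≤ (mainConst μ β D * (μ * d) * Real.exp (-(3 * μ))) ^ N :=
          pow_le_pow_left₀ hE0 (le_mainConst_mul D hμ hβ hd1) N
      _ = _ := by
          rw [mul_pow, mul_pow, ← Real.exp_nat_mul]
          congr 2
          ring
  have hpow : (2 * β * s) ^ m ≤ (y / 4) ^ m * Real.exp (-(μ * m)) := by
    have h1 : (2 * β * s) ^ m = (2 * β * s * Real.exp μ) ^ m * Real.exp (-(μ * m)) := by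
      rw [mul_pow _ (Real.exp μ), ← Real.exp_nat_mul, mul_assoc (_ ^ m), ← Real.exp_add,
        show (m : ℝ) * μ + -(μ * m) = 0 by ring, Real.exp_zero, mul_one]
    rw [h1]
    gcongr
  have hexp : Real.exp (-(3 * μ * N)) * Real.exp (-(μ * m)) = Real.exp (-μ * d) := by
    rw [← Real.exp_add, hd]
    congr 1
    ring
  have hz : y * (1 + y) ^ ((N : ℤ) - 1) * Real.exp y =
      (1 + y) ^ N * (y * Real.exp y / (1 + y)) := by
    rw [zpow_sub₀ (by positivity), zpow_one, zpow_natCast]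
    ring
  have hC : 0 ≤ (mainConst μ β D) ^ N * (μ * d) ^ N * Real.exp (-(3 * μ * N)) :=
    (pow_nonneg hE0 N).trans hEN
  rw [profile, boundFactor, G, decay, Finset.prod_div_distrib, Finset.prod_const, ← hN, ← hs, ← hy,
    hz, ← hexp]
  calc 2 * K * (E ^ N / ∏ x ∈ Z, |lam x| * Γ x) * (1 + 8 * β * s) ^ N *
        ((2 * β * s) ^ m / (m.factorial : ℝ))
      ≤ 2 * K * (((mainConst μ β D) ^ N * (μ * d) ^ N * Real.exp (-(3 * μ * N))) /
          ∏ x ∈ Z, |lam x| * Γ x) * (1 + y) ^ N *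
        ((y / 4) ^ m * Real.exp (-(μ * m)) / (m.factorial : ℝ)) := by
        gcongr
    _ = K * (((mainConst μ β D) ^ N * (μ * d) ^ N * Real.exp (-(3 * μ * N))) /
          ∏ x ∈ Z, |lam x| * Γ x) * (1 + y) ^ N * Real.exp (-(μ * m)) *
        ((2 * (1 + y) * ((y / 4) ^ m / (m.factorial : ℝ))) / (1 + y)) := by
        field_simp
    _ ≤ K * (((mainConst μ β D) ^ N * (μ * d) ^ N * Real.exp (-(3 * μ * N))) /
          ∏ x ∈ Z, |lam x| * Γ x) * (1 + y) ^ N * Real.exp (-(μ * m)) *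
        (y * Real.exp y / (1 + y)) := by
        refine mul_le_mul_of_nonneg_left (div_le_div_of_nonneg_right
          (one_add_mul_pow_div_factorial_le hy0 hm) (by positivity)) ?_
        have := div_nonneg hC hP.le
        positivity
    _ = _ := by ring

end Constants

/-! ### The chain of the theorem and its thermodynamic limit -/

section Thermodynamic

variable {D : ℕ}

lemma mem_sitesIn {F : Set ℤ} {x y z : ℤ} : z ∈ sitesIn F x y ↔ (x ≤ z ∧ z ≤ y) ∧ z ∈ F := by
  simp [sitesIn]

/-- The finite chain `[-L, L]` with bond terms `Φ` and impurities `lam x • V x` at the sites of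
`F`. -/
noncomputable def finiteChain {Φ : Finset ℤ → Op D} (hΦ : IsInteraction Φ) (F : Set ℤ)
    {V : ℤ → Matrix (Fin D) (Fin D) ℂ} (hV : ∀ x, (V x).IsHermitian) (lam : ℤ → ℝ) (L : ℕ) :
    Chain D where
  bond z := if z ∈ Finset.Ico (-(L : ℤ)) L then Φ {z, z + 1} else 0
  site z := if z ∈ sitesIn F (-(L : ℤ)) L then (lam z : ℂ) • onSite z (V z) else 0
  sites := Finset.Icc (-(L : ℤ)) L
  bond_mem z := by
    split_ifs
    · exact (hΦ _).2
    · exact zero_mem _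
  site_mem z := by
    split_ifs
    · exact SMulMemClass.smul_mem _ (onSite_mem _ _)
    · exact zero_mem _
  bond_sa z := by
    split_ifs
    · exact (hΦ _).1
    · exact IsSelfAdjoint.zero _
  site_sa z := by
    split_ifs
    · rw [IsSelfAdjoint, star_smul, (isSelfAdjoint_onSite (hV z) z).star_eq]
      simp
    · exact IsSelfAdjoint.zero _
  bond_eq_zero z hz := if_neg fun h => hz (by
    simp only [Finset.mem_Ico, Finset.mem_Icc] at *; omega)
  site_eq_zero z hz := if_neg fun h => hz (by
    rw [mem_sitesIn] at h
    exact Finset.mem_Icc.2 h.1)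

variable {Φ : Finset ℤ → Op D} (hΦ : IsInteraction Φ) (F : Set ℤ)
  {V : ℤ → Matrix (Fin D) (Fin D) ℂ} (hV : ∀ x, (V x).IsHermitian) (lam : ℤ → ℝ)

lemma ham_finiteChain (L : ℕ) :
    (finiteChain hΦ F hV lam L).ham = hamiltonian Φ F V lam L := by
  rw [Chain.ham, Finset.sum_add_distrib, hamiltonian]
  congr 1
  · simp only [finiteChain]
    rw [← Finset.sum_filter]
    refine Finset.sum_congr ?_ fun _ _ => rfl
    ext z
    simp only [Finset.mem_filter, Finset.mem_Icc, Finset.mem_Ico]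
    omega
  · simp only [finiteChain]
    rw [← Finset.sum_filter]
    refine Finset.sum_congr ?_ fun _ _ => rfl
    ext z
    simp only [Finset.mem_filter, Finset.mem_Icc, mem_sitesIn]
    tauto

lemma norm_bond_finiteChain_le (hΦb : HasFiniteNorm Φ) (L : ℕ) (z : ℤ) :
    ‖(finiteChain hΦ F hV lam L).bond z‖ ≤ interactionNorm Φ := by
  have h : ∀ z : ℤ, ‖Φ {z, z + 1}‖ ≤ interactionNorm Φ := fun z => le_ciSup hΦb z
  simp only [finiteChain]
  split_ifs
  · exact h z
  · rw [norm_zero]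
    exact (norm_nonneg _).trans (h 0)

/-- Enlarging the chain by one site on each side adds two bonds and two on-site terms. -/
lemma ham_finiteChain_succ (L : ℕ) :
    (finiteChain hΦ F hV lam (L + 1)).ham = (finiteChain hΦ F hV lam L).ham +
      ((finiteChain hΦ F hV lam (L + 1)).site (-(L : ℤ) - 1) +
        (finiteChain hΦ F hV lam (L + 1)).site (L + 1)) +
      ((finiteChain hΦ F hV lam (L + 1)).bond (-(L : ℤ) - 1) +
        (finiteChain hΦ F hV lam (L + 1)).bond L) := by
  set c' := finiteChain hΦ F hV lam (L + 1) with hc'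
  set c := finiteChain hΦ F hV lam L with hc
  have h1 : c.ham = ∑ z ∈ c'.sites, (c.bond z + c.site z) := by
    refine Finset.sum_subset (fun z hz => ?_) fun z _ hz => ?_
    · simp only [hc, hc', finiteChain, Finset.mem_Icc] at hz ⊢
      push_cast
      omega
    · rw [c.bond_eq_zero z hz, c.site_eq_zero z hz, add_zero]
  rw [h1, ← c'.sum_ite_bond, ← c'.sum_ite_bond, ← c'.sum_ite_site, ← c'.sum_ite_site, Chain.ham]
  simp only [← Finset.sum_add_distrib]
  refine Finset.sum_congr rfl fun z hz => ?_
  have hb : c'.bond z = c.bond z + ((if z = -(L : ℤ) - 1 then c'.bond z else 0) +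
      if z = L then c'.bond z else 0) := by
    by_cases h2 : z = -(L : ℤ) - 1
    · rw [if_pos h2, if_neg (by omega), c.bond_eq_zero z (by
        simp only [hc, finiteChain, Finset.mem_Icc]; omega)]
      simp
    · by_cases h3 : z = L
      · rw [if_neg h2, if_pos h3]
        have : c.bond z = 0 := by
          simp only [hc, finiteChain]
          rw [if_neg]
          simp only [Finset.mem_Ico]; omega
        rw [this]
        simp
      · rw [if_neg h2, if_neg h3]
        simp only [hc, hc', finiteChain, Finset.mem_Ico, add_zero]
        have : (-(L : ℤ) ≤ z ∧ z < L) ↔ (-((L + 1 : ℕ) : ℤ) ≤ z ∧ z < ((L + 1 : ℕ) : ℤ)) := by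
          push_cast; omega
        simp only [this]
  have hs : c'.site z = c.site z + ((if z = -(L : ℤ) - 1 then c'.site z else 0) +
      if z = (L : ℤ) + 1 then c'.site z else 0) := by
    by_cases h2 : z = -(L : ℤ) - 1
    · rw [if_pos h2, if_neg (by omega), c.site_eq_zero z (by
        simp only [hc, finiteChain, Finset.mem_Icc]; omega)]
      simp
    · by_cases h3 : z = (L : ℤ) + 1
      · rw [if_neg h2, if_pos h3, c.site_eq_zero z (by
          simp only [hc, finiteChain, Finset.mem_Icc]; omega)]
        simp
      · rw [if_neg h2, if_neg h3]
        have : z ∈ sitesIn F (-(L : ℤ)) L ↔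
            z ∈ sitesIn F (-((L + 1 : ℕ) : ℤ)) ((L + 1 : ℕ) : ℤ) := by
          rw [mem_sitesIn, mem_sitesIn]
          refine and_congr_left fun _ => ?_
          push_cast
          omega
        simp only [hc, hc', finiteChain, this, add_zero]
  conv_lhs => rw [hb, hs]
  abel

/-- The Lieb–Robinson bound that disregards all impurities. -/
lemma Chain.norm_opComm_heisenberg_le (hD : 2 ≤ D) (c : Chain D) {β : ℝ}
    (hβ : ∀ z, ‖c.bond z‖ ≤ β) {A B : Op D} {Y : Finset ℤ} (hB : B ∈ siteAlgebra D Y) {a b : ℤ}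
    (hA : IsLeftOf A a) (hY : ∀ z ∈ Y, b ≤ z) {m : ℕ} (hm : b - a = m) (t : ℝ) :
    ‖opComm (heisenberg c.ham t A) B‖ ≤
      2 * ‖A‖ * ‖B‖ * ((2 * β * |t|) ^ m / (m.factorial : ℝ)) := by
  obtain ⟨m', hm', -, h⟩ := c.exists_transportBound hD (V := fun _ => 0) (l := fun _ => 0)
    (fun _ => Matrix.isHermitian_zero) hβ hB hY m a ∅ hm (by simp) (by simp) (by simp)
  obtain rfl : m' = m := by
    simp only [Finset.card_empty] at hm'
    omega
  refine (h A hA t).trans (le_of_eq ?_)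
  simp [profile]
  ring

/-- Local observables evolve almost independently of what happens beyond the ends of a long
chain. -/
lemma norm_heisenberg_succ_sub_le {Φ : Finset ℤ → Op D} (hΦ : IsInteraction Φ) (F : Set ℤ)
    {V : ℤ → Matrix (Fin D) (Fin D) ℂ} (hV : ∀ x, (V x).IsHermitian) (lam : ℤ → ℝ)
    (hD : 2 ≤ D) (hΦb : HasFiniteNorm Φ) {k : ℕ} {A : Op D}
    (hA : A ∈ siteAlgebra D (Finset.Icc (-(k : ℤ)) k)) (n : ℕ) (t : ℝ) :
    ‖heisenberg (hamiltonian Φ F V lam (n + k + 1)) t A -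
      heisenberg (hamiltonian Φ F V lam (n + k)) t A‖ ≤
      4 * interactionNorm Φ * ‖A‖ * |t| *
        ((2 * interactionNorm Φ * |t|) ^ n / (n.factorial : ℝ)) := by
  rw [← ham_finiteChain hΦ F hV, ← ham_finiteChain hΦ F hV]
  set β := interactionNorm Φ with hβ
  set c' := finiteChain hΦ F hV lam (n + k + 1) with hc'
  set c := finiteChain hΦ F hV lam (n + k) with hc
  set L : ℤ := ((n + k : ℕ) : ℤ) with hL
  have hkL : (k : ℤ) ≤ L := by omega
  have hb : ∀ z, ‖c'.bond z‖ ≤ β := norm_bond_finiteChain_le hΦ F hV lam hΦb _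
  have hβ0 : 0 ≤ β := (norm_nonneg _).trans (hb 0)
  set S := c'.site (-L - 1) + c'.site (L + 1) with hS
  set T := c'.bond (-L - 1) + c'.bond L with hT
  have hham : c'.ham = c.ham + S + T := ham_finiteChain_succ hΦ F hV lam (n + k)
  have hAk : IsLeftOf A k := isLeftOf_of_mem hA fun z hz => (Finset.mem_Icc.1 hz).2
  -- The new on-site terms do not influence `A`.
  have hSmem : ∀ C X, C ∈ siteAlgebra D X → (∀ z ∈ X, -L ≤ z ∧ z ≤ L) → Commute C S := by
    intro C X hC hX
    refine Commute.add_right (commute_of_disjoint ?_ hC (c'.site_mem _))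
      (commute_of_disjoint ?_ hC (c'.site_mem _))
    · rw [Finset.disjoint_singleton_right]
      intro h; have := hX _ h; omega
    · rw [Finset.disjoint_singleton_right]
      intro h; have := hX _ h; omega
  have hSA : Commute S A := (hSmem A _ hA fun z hz => by rw [Finset.mem_Icc] at hz; omega).symm
  have hSc : Commute c.ham S := by
    refine Commute.sum_left _ _ _ fun z hz => Commute.add_left ?_ ?_
    · by_cases h : z ∈ Finset.Ico (-L) L
      · refine hSmem _ _ (c.bond_mem z) fun w hw => ?_
        simp only [Finset.mem_insert, Finset.mem_singleton, Finset.mem_Ico] at h hw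
        omega
      · have : c.bond z = 0 := if_neg h
        rw [this]
        exact Commute.zero_left _
    · refine hSmem _ _ (c.site_mem z) fun w hw => ?_
      have hz' : z ∈ Finset.Icc (-L) L := hz
      simp only [Finset.mem_singleton, Finset.mem_Icc] at hz' hw
      omega
  have hH₀ : ∀ s, heisenberg (c.ham + S) s A = heisenberg c.ham s A := fun s => by
    rw [heisenberg_add_hamiltonian hSc]
    exact heisenberg_of_commute (commute_heisenberg hSc.symm hSA s) s
  have hH₀sa : IsSelfAdjoint (c.ham + S) :=
    c.isSelfAdjoint_ham.add ((c'.site_sa _).add (c'.site_sa _))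
  set M : ℝ := 4 * β * ‖A‖ * ((2 * β * |t|) ^ n / (n.factorial : ℝ)) with hM
  have h := norm_heisenberg_sub_le c'.isSelfAdjoint_ham hH₀sa A (g := fun s => M * s)
    (g' := fun _ => M) (fun s => by simpa using (hasDerivAt_id s).const_mul M) (by simp) (-t)
    (fun s hs => by
      rw [abs_neg] at hs
      have hTe : c'.ham - (c.ham + S) = T := by rw [hham]; abel
      rw [hTe, hT, heisenberg_add, opComm_add_left]
      have h1 : ‖opComm (heisenberg c'.ham s (c'.bond (-L - 1))) A‖ ≤
          2 * ‖c'.bond (-L - 1)‖ * ‖A‖ * ((2 * β * |s|) ^ n / (n.factorial : ℝ)) :=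
        c'.norm_opComm_heisenberg_le hD hb hA (a := -L) (b := -k)
          (c'.isLeftOf_bond (by omega)) (fun z hz => (Finset.mem_Icc.1 hz).1) (by omega) s
      have h2 : ‖opComm (heisenberg c'.ham s (c'.bond L)) A‖ ≤
          2 * ‖A‖ * ‖c'.bond L‖ * ((2 * β * |-s|) ^ n / (n.factorial : ℝ)) := by
        rw [norm_opComm_heisenberg c'.isSelfAdjoint_ham, norm_opComm_comm]
        refine c'.norm_opComm_heisenberg_le hD hb (c'.bond_mem L) (a := k) (b := L) hAk
          (fun z hz => ?_) (by omega) (-s)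
        simp only [Finset.mem_insert, Finset.mem_singleton] at hz
        omega
      rw [abs_neg] at h2
      calc _ ≤ _ := norm_add_le _ _
        _ ≤ 2 * ‖c'.bond (-L - 1)‖ * ‖A‖ * ((2 * β * |s|) ^ n / (n.factorial : ℝ)) +
          2 * ‖A‖ * ‖c'.bond L‖ * ((2 * β * |s|) ^ n / (n.factorial : ℝ)) := add_le_add h1 h2
        _ ≤ 2 * β * ‖A‖ * ((2 * β * |t|) ^ n / (n.factorial : ℝ)) +
          2 * ‖A‖ * β * ((2 * β * |t|) ^ n / (n.factorial : ℝ)) := by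
            gcongr
            exacts [hb _, hb _]
        _ = M := by rw [hM]; ring)
  rw [neg_neg, hH₀, abs_neg] at h
  refine h.trans (le_of_eq ?_)
  rw [hM]
  ring

lemma isSelfAdjoint_hamiltonian {Φ : Finset ℤ → Op D} (hΦ : IsInteraction Φ) (F : Set ℤ)
    {V : ℤ → Matrix (Fin D) (Fin D) ℂ} (hV : ∀ x, (V x).IsHermitian) (lam : ℤ → ℝ) (L : ℕ) :
    IsSelfAdjoint (hamiltonian Φ F V lam L) := by
  rw [← ham_finiteChain hΦ F hV]
  exact Chain.isSelfAdjoint_ham _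

lemma exists_interval (X : Finset ℤ) : ∃ k : ℕ, X ⊆ Finset.Icc (-(k : ℤ)) k := by
  refine ⟨X.sup Int.natAbs, fun z hz => ?_⟩
  have := Finset.le_sup (f := Int.natAbs) hz
  rw [Finset.mem_Icc]
  omega

lemma cauchySeq_heisenberg_of_mem {Φ : Finset ℤ → Op D} (hΦ : IsInteraction Φ) (F : Set ℤ)
    {V : ℤ → Matrix (Fin D) (Fin D) ℂ} (hV : ∀ x, (V x).IsHermitian) (lam : ℤ → ℝ)
    (hD : 2 ≤ D) (hΦb : HasFiniteNorm Φ) (t : ℝ) {A : Op D}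
    {X : Finset ℤ} (hA : A ∈ siteAlgebra D X) :
    CauchySeq fun L : ℕ => heisenberg (hamiltonian Φ F V lam L) t A := by
  obtain ⟨k, hk⟩ := exists_interval X
  have hA' := siteAlgebra_mono D hk hA
  rw [← cauchySeq_shift k]
  refine cauchySeq_of_dist_le_of_summable _ (fun n => ?_)
    ((Real.summable_pow_div_factorial (2 * interactionNorm Φ * |t|)).mul_left
      (4 * interactionNorm Φ * ‖A‖ * |t|))
  rw [dist_comm, dist_eq_norm, show n.succ + k = n + k + 1 by omega]
  exact norm_heisenberg_succ_sub_le hΦ F hV lam hD hΦb hA' n t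

end Thermodynamic

section Limit

variable {D : ℕ}

lemma heisenberg_mem_quasiLocalAlgebra {H A : Op D} (hH : H ∈ quasiLocalAlgebra D)
    (hA : A ∈ quasiLocalAlgebra D) (t : ℝ) : heisenberg H t A ∈ quasiLocalAlgebra D := by
  have hexp : ∀ x ∈ quasiLocalAlgebra D, NormedSpace.exp x ∈ quasiLocalAlgebra D := by
    let _ : NormedAlgebra ℚ (Op D) := NormedAlgebra.restrictScalars ℚ ℂ (Op D)
    intro x hx
    exact NormedSpace.exp_mem (R := ℂ) (StarSubalgebra.isClosed_topologicalClosure _) hx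
  exact mul_mem (mul_mem (hexp _ (SMulMemClass.smul_mem _ hH)) hA)
    (hexp _ (SMulMemClass.smul_mem _ hH))

lemma siteAlgebra_le_quasiLocalAlgebra (X : Finset ℤ) : siteAlgebra D X ≤ quasiLocalAlgebra D :=
  (le_iSup (siteAlgebra D) X).trans (StarSubalgebra.le_topologicalClosure _)

lemma hamiltonian_mem_quasiLocalAlgebra {Φ : Finset ℤ → Op D} (hΦ : IsInteraction Φ) (F : Set ℤ)
    (V : ℤ → Matrix (Fin D) (Fin D) ℂ) (lam : ℤ → ℝ) (L : ℕ) :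
    hamiltonian Φ F V lam L ∈ quasiLocalAlgebra D :=
  add_mem (sum_mem fun _ _ => siteAlgebra_le_quasiLocalAlgebra _ (hΦ _).2)
    (sum_mem fun _ _ => SMulMemClass.smul_mem _
      (siteAlgebra_le_quasiLocalAlgebra _ (onSite_mem _ _)))

lemma cauchySeq_heisenberg {Φ : Finset ℤ → Op D} (hΦ : IsInteraction Φ) (F : Set ℤ)
    {V : ℤ → Matrix (Fin D) (Fin D) ℂ} (hV : ∀ x, (V x).IsHermitian) (lam : ℤ → ℝ)
    (hD : 2 ≤ D) (hΦb : HasFiniteNorm Φ) (t : ℝ) {A : Op D} (hA : A ∈ quasiLocalAlgebra D) :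
    CauchySeq fun L : ℕ => heisenberg (hamiltonian Φ F V lam L) t A := by
  rw [Metric.cauchySeq_iff']
  intro ε hε
  have hA' : A ∈ closure (localAlgebra D : Set (Op D)) := hA
  obtain ⟨A', hA'mem, hdist⟩ := Metric.mem_closure_iff.1 hA' (ε / 3) (by positivity)
  rw [coe_localAlgebra, Set.mem_iUnion] at hA'mem
  obtain ⟨X, hX⟩ := hA'mem
  obtain ⟨n₀, hn₀⟩ := Metric.cauchySeq_iff'.1
    (cauchySeq_heisenberg_of_mem hΦ F hV lam hD hΦb t hX) (ε / 3) (by positivity)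
  have hclose : ∀ L : ℕ, dist (heisenberg (hamiltonian Φ F V lam L) t A)
      (heisenberg (hamiltonian Φ F V lam L) t A') < ε / 3 := fun L => by
    rw [dist_eq_norm, ← heisenberg_sub, norm_heisenberg (isSelfAdjoint_hamiltonian hΦ F hV lam L),
      ← dist_eq_norm]
    exact hdist
  refine ⟨n₀, fun n hn => ?_⟩
  have h1 := hclose n
  have h2 := hn₀ n hn
  have h3 := hclose n₀
  rw [dist_comm] at h3
  linarith [dist_triangle4 (heisenberg (hamiltonian Φ F V lam n) t A)
    (heisenberg (hamiltonian Φ F V lam n) t A') (heisenberg (hamiltonian Φ F V lam n₀) t A')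
    (heisenberg (hamiltonian Φ F V lam n₀) t A)]

/-- The dynamics of the infinite chain.  The limits respect the algebraic operations because the
finite-volume dynamics do, and `τ (-t)` is the inverse of `τ t` because those are isometric. -/
lemma exists_limit_dynamics {Φ : Finset ℤ → Op D} (hΦ : IsInteraction Φ) (F : Set ℤ)
    {V : ℤ → Matrix (Fin D) (Fin D) ℂ} (hV : ∀ x, (V x).IsHermitian) (lam : ℤ → ℝ)
    (hD : 2 ≤ D) (hΦb : HasFiniteNorm Φ) :
    ∃ τ : ℝ → (quasiLocalAlgebra D ≃⋆ₐ[ℂ] quasiLocalAlgebra D),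
      ∀ (t : ℝ) (A : quasiLocalAlgebra D),
        Tendsto (fun L : ℕ => heisenberg (hamiltonian Φ F V lam L) t (A : Op D)) atTop
          (𝓝 (τ t A : Op D)) := by
  have hex : ∀ (t : ℝ) (A : quasiLocalAlgebra D), ∃ T : quasiLocalAlgebra D,
      Tendsto (fun L : ℕ => heisenberg (hamiltonian Φ F V lam L) t (A : Op D)) atTop
        (𝓝 (T : Op D)) := by
    intro t A
    obtain ⟨T, hT⟩ := cauchySeq_tendsto_of_complete
      (cauchySeq_heisenberg hΦ F hV lam hD hΦb t A.2)
    have hmem : T ∈ quasiLocalAlgebra D :=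
      (StarSubalgebra.isClosed_topologicalClosure (localAlgebra D)).mem_of_tendsto hT
        (Eventually.of_forall fun L => heisenberg_mem_quasiLocalAlgebra
          (hamiltonian_mem_quasiLocalAlgebra hΦ F V lam L) A.2 t)
    exact ⟨⟨T, hmem⟩, hT⟩
  choose f hf using hex
  -- Finite-volume evolutions are isometric, so they may be applied to convergent sequences.
  have hinv : ∀ t A, f (-t) (f t A) = A := by
    intro t A
    refine Subtype.ext (tendsto_nhds_unique (hf (-t) (f t A)) ?_)
    rw [tendsto_iff_norm_sub_tendsto_zero]
    have h := tendsto_iff_norm_sub_tendsto_zero.1 (hf t A)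
    refine h.congr fun L => ?_
    have hsa := isSelfAdjoint_hamiltonian hΦ F hV lam L
    rw [norm_sub_rev, ← norm_heisenberg hsa (-t), heisenberg_sub, heisenberg_neg_heisenberg]
  refine ⟨fun t =>
    { toFun := f t
      invFun := f (-t)
      left_inv := hinv t
      right_inv := fun A => by simpa using hinv (-t) A
      map_mul' := fun A B => Subtype.ext (tendsto_nhds_unique (hf t (A * B)) ?_)
      map_add' := fun A B => Subtype.ext (tendsto_nhds_unique (hf t (A + B)) ?_)
      map_star' := fun A => Subtype.ext (tendsto_nhds_unique (hf t (star A)) ?_)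
      map_smul' := fun c A => Subtype.ext (tendsto_nhds_unique (hf t (c • A)) ?_) }, hf⟩
  · exact ((hf t A).mul (hf t B)).congr fun L => (heisenberg_mul _ t _ _).symm
  · exact ((hf t A).add (hf t B)).congr fun L => (heisenberg_add _ t _ _).symm
  · exact (hf t A).star.congr fun L =>
      (heisenberg_star (isSelfAdjoint_hamiltonian hΦ F hV lam L) t _).symm
  · exact ((hf t A).const_smul c).congr fun L => (heisenberg_smul _ t c _).symm

/-! ### The bound for finite chains -/

lemma three_le_of_minSpacing {F : Set ℤ} {μ : ℝ}
    (hF : ((max (1 / μ) 2 : ℝ) : EReal) < minSpacing F) {x y : ℤ} (hx : x ∈ F) (hy : y ∈ F)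
    (hxy : x < y) : x + 3 ≤ y := by
  have h1 : minSpacing F ≤ ((|(x : ℝ) - y| : ℝ) : EReal) :=
    iInf_le_of_le x (iInf_le_of_le hx (iInf_le_of_le y (iInf_le_of_le hy (iInf_le _ hxy.ne))))
  have h2 : max (1 / μ) 2 < |(x : ℝ) - y| := EReal.coe_lt_coe_iff.1 (hF.trans_le h1)
  have h3 : (2 : ℝ) < |(x : ℝ) - y| := (le_max_right _ _).trans_lt h2
  have h4 : (2 : ℤ) < |x - y| := by exact_mod_cast h3
  rw [abs_of_neg (by omega)] at h4
  omega

lemma setDist_Icc {a₁ a₂ b₁ b₂ : ℤ} (ha : a₁ ≤ a₂) (hb : b₁ ≤ b₂) (hab : a₂ ≤ b₁) :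
    setDist (Set.Icc a₁ a₂) (Set.Icc b₁ b₂) = b₁ - a₂ := by
  refine IsLeast.csInf_eq ⟨⟨a₂, ⟨ha, le_rfl⟩, b₁, ⟨le_rfl, hb⟩, ?_⟩, ?_⟩
  · have : (a₂ : ℝ) ≤ b₁ := by exact_mod_cast hab
    change |(a₂ : ℝ) - b₁| = b₁ - a₂
    rw [abs_sub_comm, abs_of_nonneg (by linarith)]
  · rintro _ ⟨x, hx, y, hy, rfl⟩
    have h1 : (x : ℝ) ≤ a₂ := by exact_mod_cast hx.2
    have h2 : (b₁ : ℝ) ≤ y := by exact_mod_cast hy.1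
    simp only
    rw [abs_sub_comm]
    exact le_trans (by linarith) (le_abs_self _)

/-- The bound for a finite chain.  The supports of the observables may stick out of the chain. -/
theorem norm_opComm_heisenberg_hamiltonian_le (hD : 2 ≤ D)
    {Φ : Finset ℤ → Op D} (hΦ : IsInteraction Φ) (hΦb : HasFiniteNorm Φ) {F : Set ℤ}
    {V : ℤ → Matrix (Fin D) (Fin D) ℂ} (hV : ∀ x, (V x).IsHermitian)
    (hγ : ∀ x ∈ F, Function.Injective (hV x).eigenvalues) {μ : ℝ} (hμ : 0 < μ)
    (hF : ∀ x ∈ F, ∀ y ∈ F, x < y → x + 3 ≤ y) {lam : ℤ → ℝ} (hlam : ∀ x ∈ F, lam x ≠ 0) (L : ℕ)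
    {A B : Op D} {a₁ a₂ b₁ b₂ : ℤ} (ha : a₁ ≤ a₂) (hb : b₁ ≤ b₂)
    (hA : A ∈ siteAlgebra D (Finset.Icc a₁ a₂)) (hB : B ∈ siteAlgebra D (Finset.Icc b₁ b₂))
    (hab : a₂ + 3 < b₁ - 3) (t : ℝ) :
    ‖opComm (heisenberg (hamiltonian Φ F V lam L) t A) B‖ ≤
      boundFactor D μ (interactionNorm Φ) lam (fun x => spectralGap (hV x))
        (sitesIn F (a₂ + 3) (b₁ - 3)) t (setDist (Set.Icc a₁ a₂) (Set.Icc b₁ b₂)) *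
          ‖A‖ * ‖B‖ := by
  rw [← ham_finiteChain hΦ F hV]
  set c := finiteChain hΦ F hV lam L with hc
  set Z := sitesIn F (a₂ + 3) (b₁ - 3) with hZ
  have hβ : ∀ z, ‖c.bond z‖ ≤ interactionNorm Φ := norm_bond_finiteChain_le hΦ F hV lam hΦb L
  have hβ0 : 0 ≤ interactionNorm Φ := (norm_nonneg _).trans (hβ 0)
  have hZF : ∀ x ∈ Z, (a₂ + 3 ≤ x ∧ x ≤ b₁ - 3) ∧ x ∈ F := fun x hx => mem_sitesIn.1 hx
  obtain ⟨m, hm, hm1, hT⟩ := c.exists_transportBound hD hV (l := lam) hβ hB (b := b₁)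
    (fun z hz => (Finset.mem_Icc.1 hz).1) (b₁ - a₂).toNat a₂ Z (by omega)
    (fun x hx => by
      obtain ⟨-, hxF⟩ := hZF x hx
      refine ⟨hlam x hxF, hγ x hxF, ?_⟩
      by_cases hxL : -(L : ℤ) ≤ x ∧ x ≤ L
      · refine Or.inr ⟨if_pos (mem_sitesIn.2 ⟨hxL, hxF⟩), if_neg fun h => ?_, if_neg fun h => ?_⟩
        · have := hF _ (mem_sitesIn.1 h).2 x hxF (by omega)
          omega
        · have := hF x hxF _ (mem_sitesIn.1 h).2 (by omega)
          omega
      · refine Or.inl (if_neg fun h => hxL ?_)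
        rw [Finset.mem_Ico] at h
        omega)
    (fun x hx x' hx' => hF x (hZF x hx).2 x' (hZF x' hx').2)
    (fun x hx => by have := (hZF x hx).1; omega)
  have hd : setDist (Set.Icc a₁ a₂) (Set.Icc b₁ b₂) = (m : ℝ) + 3 * Z.card := by
    rw [setDist_Icc ha hb (by omega)]
    exact_mod_cast hm.symm
  have h1 := hT A (isLeftOf_of_mem hA fun z hz => (Finset.mem_Icc.1 hz).2) t
  have h2 := profile_le_boundFactor (D := D) (lam := lam) (Γ := fun x => spectralGap (hV x)) hμ hβ0
    (Z := Z) (fun x hx => mul_pos (abs_pos.2 (hlam x (hZF x hx).2))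
      (spectralGap_pos (hV x) hD (hγ x (hZF x hx).2))) (hm1 (by omega)) hd t ‖B‖ (norm_nonneg B)
  calc _ ≤ _ := h1
    _ ≤ ‖A‖ * _ := mul_le_mul_of_nonneg_left h2 (norm_nonneg A)
    _ = _ := by ring

end Limit

end SpinChain

theorem theorem3p1
    (D : ℕ) (hD : 2 ≤ D)
    (Φ : Finset ℤ → Op D) (hΦ : IsInteraction Φ) (hΦnn : IsNearestNeighbor Φ)
    (hΦb : HasFiniteNorm Φ)
    (F : Set ℤ)
    (V : ℤ → Matrix (Fin D) (Fin D) ℂ) (hV : ∀ x, (V x).IsHermitian)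
    (hγ : ∀ x ∈ F, Function.Injective (hV x).eigenvalues)
    (μ : ℝ) (hμ : 0 < μ)
    (hF : ((max (1 / μ) 2 : ℝ) : EReal) < minSpacing F) :
    (0 < interactionNorm Φ → 0 < mainConst μ (interactionNorm Φ) D) ∧
    ∀ lam : ℤ → ℝ, (∀ x ∈ F, lam x ≠ 0) →
      -- finite chains
      (∀ (L : ℕ) (A B : Op D),
        A ∈ siteAlgebra D (Finset.Icc (-(L : ℤ)) L) →
        B ∈ siteAlgebra D (Finset.Icc (-(L : ℤ)) L) →
        ∀ a₁ a₂ b₁ b₂ : ℤ, IsSupport A a₁ a₂ → IsSupport B b₁ b₂ → a₂ + 3 < b₁ - 3 →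
        ∀ t : ℝ,
          ‖opComm (heisenberg (hamiltonian Φ F V lam L) t A) B‖ ≤
            boundFactor D μ (interactionNorm Φ) lam (fun x => spectralGap (hV x))
                (sitesIn F (a₂ + 3) (b₁ - 3)) t (setDist (Set.Icc a₁ a₂) (Set.Icc b₁ b₂)) *
              ‖A‖ * ‖B‖) ∧
      -- the thermodynamic limit exists and obeys the same bound
      ∃ τ : ℝ → (quasiLocalAlgebra D ≃⋆ₐ[ℂ] quasiLocalAlgebra D),
        (∀ (t : ℝ) (A : quasiLocalAlgebra D),
          Tendsto (fun L : ℕ => heisenberg (hamiltonian Φ F V lam L) t (A : Op D)) atTop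
            (𝓝 (τ t A : Op D))) ∧
        ∀ A B : quasiLocalAlgebra D,
        ∀ a₁ a₂ b₁ b₂ : ℤ, IsSupport (A : Op D) a₁ a₂ → IsSupport (B : Op D) b₁ b₂ →
        a₂ + 3 < b₁ - 3 →
        ∀ t : ℝ,
          ‖opComm (τ t A : Op D) (B : Op D)‖ ≤
            boundFactor D μ (interactionNorm Φ) lam (fun x => spectralGap (hV x))
                (sitesIn F (a₂ + 3) (b₁ - 3)) t (setDist (Set.Icc a₁ a₂) (Set.Icc b₁ b₂)) *
              ‖A‖ * ‖B‖ := by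

  have hsp : ∀ x ∈ F, ∀ y ∈ F, x < y → x + 3 ≤ y := fun x hx y hy hxy =>
    three_le_of_minSpacing hF hx hy hxy
  refine ⟨fun hpos => mainConst_pos hD hμ hpos, fun lam hlam => ⟨?_, ?_⟩⟩
  · intro L A B _ _ a₁ a₂ b₁ b₂ hA hB hab t
    exact norm_opComm_heisenberg_hamiltonian_le hD hΦ hΦb hV hγ hμ hsp hlam L hA.1 hB.1 hA.2.1
      hB.2.1 hab t
  · obtain ⟨τ, hτ⟩ := exists_limit_dynamics hΦ F hV lam hD hΦb
    refine ⟨τ, hτ, fun A B a₁ a₂ b₁ b₂ hA hB hab t => ?_⟩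
    have hlim : Tendsto
        (fun L : ℕ => ‖opComm (heisenberg (hamiltonian Φ F V lam L) t (A : Op D)) (B : Op D)‖) atTop
        (𝓝 ‖opComm (τ t A : Op D) (B : Op D)‖) :=
      (((hτ t A).mul_const _).sub ((hτ t A).const_mul _)).norm
    exact le_of_tendsto hlim (Eventually.of_forall fun L =>
      norm_opComm_heisenberg_hamiltonian_le hD hΦ hΦb hV hγ hμ hsp hlam L hA.1 hB.1 hA.2.1
        hB.2.1 hab t)
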